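/- Let $S$ be a symmetric invertible real $d\times d$ matrix with $m\in\{0,1,\dots,d\}$ positive eigenvalues and write $S(x,y):=\langle x,Sy\rangle$ for $x,y\in\mathbb{R}^d$. Let $\nu$ be a Borel probability measure on $\mathbb{R}^d$ with finite second moment, and let $\Gamma(\nu)$ be the set of Borel probability measures $\gamma$ on $\mathbb{R}^d\times\mathbb{R}^d$ with finite second moments such that $\gamma(\mathbb{R}^d,dy)=\nu(dy)$ and $\gamma(y\mid x)=x$, where $\gamma(y\mid x)$ is the conditional expectation under $\gamma$ of the second coordinate given the first one. A set $G\subset\mathbb{R}^d$ is $S$-monotone if $S(x-y,x-y)\ge 0$ for all $x,y\in G$, and maximal $S$-monotone if, in addition, it is not a strict subset of an $S$-monotone set; let $\mathfrak{M}(S)$ be the family of maximal $S$-monotone sets. For $G\in\mathfrak{M}(S)$ and $y\in\mathbb{R}^d$ put $$\psi_G(y):=\sup_{x\in G}\Bigl(S(x,y)-\tfrac12 S(x,x)\Bigr)\in(-\infty,+\infty],\qquad P_G(y):=\operatorname*{argmin}_{x\in G}S(x-y,x-y)\subset G.$$ For any $\gamma\in\Gamma(\nu)$ and $G\in\mathfrak{M}(S)$,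 the following conditions are equivalent: (a) $\gamma$ maximizes $\frac12\int S(x,y)\,d\gamma$ over $\Gamma(\nu)$, and $G$ minimizes $\int\psi_G\,d\nu$ over $\mathfrak{M}(S)$; (b) $x\in P_G(y)$ for every $(x,y)\in\operatorname{supp}\gamma$; (c) $x\in P_G(x)\subset P_G(y)$ for $\gamma$-almost every $(x,y)$. -/

import Mathlib

open MeasureTheory
open scoped ENNReal

noncomputable section

namespace BackwardTransport

/-- `S` is a symmetric `d × d` matrix of full rank with exactly `m` positive eigenvalues,
counted with multiplicity (over `ℝ`, Hermitian means symmetric). -/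
structure IsSymWithIndex (d m : ℕ) (S : Matrix (Fin d) (Fin d) ℝ) : Prop where
  isHermitian : S.IsHermitian
  rank_eq : S.rank = d
  card_pos : Fintype.card {i : Fin d // 0 < isHermitian.eigenvalues i} = m

variable {d : ℕ}

/-- The pseudo-Euclidean scalar product `S(x,y) = ⟨x, S y⟩`. -/
def sProd (S : Matrix (Fin d) (Fin d) ℝ) (x y : EuclideanSpace ℝ (Fin d)) : ℝ :=
  inner ℝ x (Matrix.toEuclideanLin S y)

/-- Backward martingale plans: Borel probability measures `γ` on `ℝᵈ × ℝᵈ` with finite second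
moments, second marginal `ν`, and `γ(y | x) = x`. -/
structure IsPlan (ν : Measure (EuclideanSpace ℝ (Fin d)))
    (γ : Measure (EuclideanSpace ℝ (Fin d) × EuclideanSpace ℝ (Fin d))) : Prop where
  isProbabilityMeasure : IsProbabilityMeasure γ
  memLp_two : MemLp (fun p => p) 2 γ
  map_snd : γ.map Prod.snd = ν
  condExp_snd : γ[Prod.snd | MeasurableSpace.comap Prod.fst inferInstance] =ᵐ[γ] Prod.fst

/-- The value `½ ∫ S(x,y) dγ` of a plan. -/
def planValue (S : Matrix (Fin d) (Fin d) ℝ)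
    (γ : Measure (EuclideanSpace ℝ (Fin d) × EuclideanSpace ℝ (Fin d))) : ℝ :=
  1 / 2 * ∫ p, sProd S p.1 p.2 ∂γ

/-- `γ` maximizes `½ ∫ S(x,y) dγ` over all backward martingale plans. -/
def IsOptimalPlan (S : Matrix (Fin d) (Fin d) ℝ) (ν : Measure (EuclideanSpace ℝ (Fin d)))
    (γ : Measure (EuclideanSpace ℝ (Fin d) × EuclideanSpace ℝ (Fin d))) : Prop :=
  IsPlan ν γ ∧ ∀ γ', IsPlan ν γ' → planValue S γ' ≤ planValue S γ

/-- `S`-monotone sets. -/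
def SMonotone (S : Matrix (Fin d) (Fin d) ℝ) (G : Set (EuclideanSpace ℝ (Fin d))) : Prop :=
  ∀ x ∈ G, ∀ y ∈ G, 0 ≤ sProd S (x - y) (x - y)

/-- Maximal `S`-monotone sets: not a strict subset of an `S`-monotone set. -/
def MaximalSMonotone (S : Matrix (Fin d) (Fin d) ℝ)
    (G : Set (EuclideanSpace ℝ (Fin d))) : Prop :=
  SMonotone S G ∧ ∀ H, SMonotone S H → ¬ G ⊂ H

/-- The Fitzpatrick function `ψ_G(y) = sup_{x ∈ G} (S(x,y) - ½ S(x,x))`, which may be `+∞`. -/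
def fitzpatrick (S : Matrix (Fin d) (Fin d) ℝ) (G : Set (EuclideanSpace ℝ (Fin d)))
    (y : EuclideanSpace ℝ (Fin d)) : EReal :=
  ⨆ x ∈ G, ((sProd S x y - 1 / 2 * sProd S x x : ℝ) : EReal)

/-- The integral of an extended real function: the integral of its positive part minus the
integral of its negative part. For `fitzpatrick S G` with `G` nonempty and `ν` with a finite
first moment, the negative part has a finite integral, because `fitzpatrick S G` has an
affine minorant. -/
def erealIntegral {α : Type*} [MeasurableSpace α] (f : α → EReal) (ν : Measure α) : EReal :=
  ((∫⁻ y, (f y).toENNReal ∂ν : ℝ≥0∞) : EReal) - ((∫⁻ y, (-f y).toENNReal ∂ν : ℝ≥0∞) : EReal)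

/-- `G` minimizes `∫ ψ_G dν` over all maximal `S`-monotone sets. -/
def IsOptimalSet (S : Matrix (Fin d) (Fin d) ℝ) (ν : Measure (EuclideanSpace ℝ (Fin d)))
    (G : Set (EuclideanSpace ℝ (Fin d))) : Prop :=
  MaximalSMonotone S G ∧ ∀ H, MaximalSMonotone S H →
    erealIntegral (fitzpatrick S G) ν ≤ erealIntegral (fitzpatrick S H) ν

/-- The projection on `G` in the `S`-space: `P_G(y) = argmin_{x ∈ G} S(x - y, x - y)`. -/
def sProj (S : Matrix (Fin d) (Fin d) ℝ) (G : Set (EuclideanSpace ℝ (Fin d)))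
    (y : EuclideanSpace ℝ (Fin d)) : Set (EuclideanSpace ℝ (Fin d)) :=
  {x | x ∈ G ∧ ∀ z ∈ G, sProd S (x - y) (x - y) ≤ sProd S (z - y) (z - y)}

end BackwardTransport

end

/-!
Write `q(x) = S(x, x)`. A maximal `S`-monotone set `G` satisfies `ψ_G ≥ ½ q`, with equality only on
`G`. Since `ψ_G` is a supremum of affine functions and `x` is the conditional mean of `y`, every
plan `γ` satisfies `∫ ψ_G dν ≥ ∫ ψ_G(x) dγ ≥ ½ ∫ q(x) dγ = ½ ∫ S(x, y) dγ`. This is weak duality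
(`IsPlan.planValue_le`). Equality forces `x ∈ G` and `ψ_G(y) = S(x, y) - ½ q(x)`, that is,
`x ∈ P_G(y)` almost surely (`IsPlan.ae_mem_sProj`), and conversely (`IsPlan.erealIntegral_eq`).
The inclusion `P_G(x) ⊆ P_G(y)` follows because, for `z ∈ P_G(x)`, the quantity `S(z - x, y - x)` is
nonpositive with zero conditional mean (`IsPlan.ae_sProj_subset`).

It remains to see that an optimal plan `γ` has no duality gap
(`IsOptimalPlan.exists_maximalSMonotone`). If one removes the mass `ε θ γ` from `γ`, corrects the
first coordinate of the rest so that it is again the conditional mean, and gathers the removed mass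
at its own mean, the first-order change of the value is nonpositive. Hence
`½ q(∫ θ y dγ) ≤ ∫ θ (S(x, y) - ½ q(x)) dγ` for all bounded densities `θ`
(`IsOptimalPlan.sProd_mean_le`). In other words, the convex set of averages of the points
`(y, S(x, y) - ½ q(x))` lies in the epigraph of `½ q`. By Zorn's lemma it is contained in a maximal
convex subset `C` of this epigraph, which is closed. The tangents of `½ q` at the points where `C`
touches its graph support `C` from below, so the Fitzpatrick function of the contact set is at most
`S(x, y) - ½ q(x)` at `y`, for `(x, y)` in the support of `γ`.

The contact set is maximal `S`-monotone (`IsMaxConvex.maximalSMonotone_contactSet`). To see this,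
let `J` be the operator of the signs of the eigenvalues of `S`, and let `z` be monotonically related
to the contact set. The minimizer `(v, t)` over `C` of
`t - S(z, v) + ½ q(z) + ½ S(J(v - z), v - z)` gives a point `z - J(v - z)`, which belongs to the
contact set because `C` is maximal. Monotonicity with respect to `z` then forces `v = z`.
-/

namespace BackwardTransport

open Filter Topology

variable {d : ℕ} {S : Matrix (Fin d) (Fin d) ℝ}

local notation "E" d => EuclideanSpace ℝ (Fin d)

/-! ### The scalar product `S(x, y)` -/

lemma sProd_add_left (x y z : E d) : sProd S (x + y) z = sProd S x z + sProd S y z := by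
  simp [sProd, inner_add_left]

lemma sProd_add_right (x y z : E d) : sProd S x (y + z) = sProd S x y + sProd S x z := by
  simp [sProd, inner_add_right]

lemma sProd_sub_left (x y z : E d) : sProd S (x - y) z = sProd S x z - sProd S y z := by
  simp [sProd, inner_sub_left]

lemma sProd_sub_right (x y z : E d) : sProd S x (y - z) = sProd S x y - sProd S x z := by
  simp [sProd, inner_sub_right]

lemma sProd_smul_left (c : ℝ) (x y : E d) : sProd S (c • x) y = c * sProd S x y := by
  simp [sProd, inner_smul_left]

lemma sProd_smul_right (c : ℝ) (x y : E d) : sProd S x (c • y) = c * sProd S x y := by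
  simp [sProd, inner_smul_right]

lemma IsSymWithIndex.sProd_comm {m : ℕ} (hS : IsSymWithIndex d m S) (x y : E d) :
    sProd S x y = sProd S y x := by
  have h := (Matrix.isSymmetric_toEuclideanLin_iff.mpr hS.isHermitian) x y
  rw [sProd, ← h, real_inner_comm]; rfl

@[fun_prop]
lemma continuous_sProd {X : Type*} [TopologicalSpace X] {f g : X → E d} (hf : Continuous f)
    (hg : Continuous g) : Continuous fun x => sProd S (f x) (g x) := by
  have : Continuous (Matrix.toEuclideanLin S) := LinearMap.continuous_of_finiteDimensional _
  unfold sProd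
  fun_prop

lemma exists_abs_sProd_le (S : Matrix (Fin d) (Fin d) ℝ) :
    ∃ C, 0 ≤ C ∧ ∀ x y : E d, |sProd S x y| ≤ C * ‖x‖ * ‖y‖ := by
  let T := LinearMap.toContinuousLinearMap (Matrix.toEuclideanLin S)
  refine ⟨‖T‖, norm_nonneg _, fun x y => ?_⟩
  have h1 : |sProd S x y| ≤ ‖x‖ * ‖T y‖ := abs_real_inner_le_norm x (T y)
  have h2 := T.le_opNorm y
  nlinarith [norm_nonneg x]

/-- `J` preserves `S`, and `S(J·, ·)` is a symmetric form that dominates `-S` and is at least `c`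
times the Euclidean scalar product. An example, in eigencoordinates of `S`, is the multiplication
by the signs of the eigenvalues. -/
structure IsSignOperator (S : Matrix (Fin d) (Fin d) ℝ) (J : (E d) →ₗ[ℝ] (E d)) (c : ℝ) :
    Prop where
  pos : 0 < c
  isometry : ∀ p, sProd S (J p) (J p) = sProd S p p
  symm : ∀ p u, sProd S (J p) u = sProd S p (J u)
  dominates : ∀ p, 0 ≤ sProd S (J p) p + sProd S p p
  coercive : ∀ p, c * ‖p‖ ^ 2 ≤ sProd S (J p) p

lemma IsSymWithIndex.exists_isSignOperator {m : ℕ} (hS : IsSymWithIndex d m S) :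
    ∃ J c, IsSignOperator S J c := by
  set b := hS.isHermitian.eigenvectorBasis with hb
  set ev := hS.isHermitian.eigenvalues with hev
  have hne : ∀ i, ev i ≠ 0 := by
    have h := hS.isHermitian.rank_eq_card_non_zero_eigs
    rw [hS.rank_eq] at h
    by_contra! hcon
    obtain ⟨i, hi⟩ := hcon
    have hlt : Fintype.card {i // hS.isHermitian.eigenvalues i ≠ 0} < Fintype.card (Fin d) :=
      Fintype.card_subtype_lt (x := i) (by simpa using hi)
    simp only [Fintype.card_fin] at hlt
    omega
  -- in eigencoordinates `S` is diagonal
  have hdiag : ∀ x y : E d, sProd S x y = ∑ i, ev i * (inner ℝ (b i) x * inner ℝ (b i) y) := by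
    intro x y
    have hA : ∀ i, Matrix.toEuclideanLin S (b i) = ev i • b i := by
      intro i
      have := hS.isHermitian.mulVec_eigenvectorBasis i
      ext j
      simpa [Matrix.toLpLin_apply] using congrFun this j
    rw [sProd, ← b.sum_inner_mul_inner]
    refine Finset.sum_congr rfl fun i _ => ?_
    rw [← (Matrix.isSymmetric_toEuclideanLin_iff.mpr hS.isHermitian) (b i) y, hA,
      real_inner_smul_left, real_inner_comm]
    ring
  let J : (E d) →ₗ[ℝ] (E d) :=
    ∑ i, (SignType.sign (ev i) : ℝ) • (innerₛₗ ℝ (b i)).smulRight (b i)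
  have hJ : ∀ x i, inner ℝ (b i) (J x) = (SignType.sign (ev i) : ℝ) * inner ℝ (b i) x := by
    intro x i
    simp only [J, LinearMap.sum_apply, LinearMap.smul_apply, LinearMap.smulRight_apply,
      inner_sum, real_inner_smul_right, innerₛₗ_apply_apply]
    rw [Finset.sum_eq_single i]
    · simp
    · intro j _ hj
      simp [b.inner_eq_zero (Ne.symm hj)]
    · simp
  have hsq : ∀ i, (SignType.sign (ev i) : ℝ) * (SignType.sign (ev i) : ℝ) = 1 := by
    intro i
    rcases lt_or_gt_of_ne (hne i) with h | h <;> simp [h]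
  have habs : ∀ i, ev i * (SignType.sign (ev i) : ℝ) = |ev i| := fun i => self_mul_sign _
  obtain ⟨c, hc, hcle⟩ : ∃ c, 0 < c ∧ ∀ i, c ≤ |ev i| := by
    rcases isEmpty_or_nonempty (Fin d) with h | h
    · exact ⟨1, one_pos, fun i => h.elim i⟩
    · obtain ⟨i, hi⟩ := Finite.exists_min fun i => |ev i|
      exact ⟨|ev i|, abs_pos.mpr (hne i), hi⟩
  refine ⟨J, c, hc, fun p => ?_, fun p u => ?_, fun p => ?_, fun p => ?_⟩
  · rw [hdiag, hdiag]
    refine Finset.sum_congr rfl fun i _ => ?_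
    rw [hJ, show ∀ s a e : ℝ, e * (s * a * (s * a)) = s * s * (e * (a * a)) by intros; ring, hsq,
      one_mul]
  · rw [hdiag, hdiag]
    refine Finset.sum_congr rfl fun i _ => ?_
    rw [hJ, hJ]
    ring
  · rw [hdiag, hdiag, ← Finset.sum_add_distrib]
    refine Finset.sum_nonneg fun i _ => ?_
    rw [hJ, show ∀ s a e : ℝ, e * (s * a * a) + e * (a * a) = (e * s + e) * (a * a) by
      intros; ring, habs]
    exact mul_nonneg (by linarith [neg_abs_le (ev i)]) (mul_self_nonneg _)
  · rw [hdiag, ← b.sum_sq_norm_inner_right p, Finset.mul_sum]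
    refine Finset.sum_le_sum fun i _ => ?_
    rw [hJ, show ∀ s a e : ℝ, e * (s * a * a) = (e * s) * a ^ 2 by intros; ring, habs,
      Real.norm_eq_abs, sq_abs]
    exact mul_le_mul_of_nonneg_right (hcle i) (sq_nonneg _)

/-! ### Maximal convex sets above the quadratic form -/

/-- The epigraph of `½ S(y, y)`. -/
def quadEpigraph (S : Matrix (Fin d) (Fin d) ℝ) : Set ((E d) × ℝ) :=
  {p | 1 / 2 * sProd S p.1 p.1 ≤ p.2}

/-- Convex subsets of `quadEpigraph S` that are maximal for inclusion. They encode the epigraphs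
of the minimal convex functions that dominate `½ S(y, y)`. -/
def IsMaxConvex (S : Matrix (Fin d) (Fin d) ℝ) (C : Set ((E d) × ℝ)) : Prop :=
  Maximal (fun D => Convex ℝ D ∧ D ⊆ quadEpigraph S) C

/-- The points at which a set above the graph of `½ S(y, y)` touches this graph. -/
def contactSet (S : Matrix (Fin d) (Fin d) ℝ) (C : Set ((E d) × ℝ)) : Set (E d) :=
  {z | (z, 1 / 2 * sProd S z z) ∈ C}

lemma isClosed_quadEpigraph : IsClosed (quadEpigraph S) :=
  isClosed_le (by fun_prop) (by fun_prop)

lemma mem_quadEpigraph {p : (E d) × ℝ} :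
    p ∈ quadEpigraph S ↔ 1 / 2 * sProd S p.1 p.1 ≤ p.2 := Iff.rfl

lemma IsMaxConvex.convex {C : Set ((E d) × ℝ)} (hC : IsMaxConvex S C) : Convex ℝ C :=
  (Maximal.prop hC).1

lemma IsMaxConvex.subset {C : Set ((E d) × ℝ)} (hC : IsMaxConvex S C) : C ⊆ quadEpigraph S :=
  (Maximal.prop hC).2

lemma IsMaxConvex.eq_of_subset {C D : Set ((E d) × ℝ)} (hC : IsMaxConvex S C) (hD : Convex ℝ D)
    (hDS : D ⊆ quadEpigraph S) (hCD : C ⊆ D) : C = D :=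
  Maximal.eq_of_subset hC ⟨hD, hDS⟩ hCD

lemma exists_isMaxConvex_superset {D : Set ((E d) × ℝ)} (hD : Convex ℝ D)
    (hDS : D ⊆ quadEpigraph S) : ∃ C, D ⊆ C ∧ IsMaxConvex S C := by
  refine zorn_subset_nonempty {D | Convex ℝ D ∧ D ⊆ quadEpigraph S} ?_ D ⟨hD, hDS⟩
  intro c hc hchain _
  exact ⟨⋃₀ c, ⟨hchain.directedOn.convex_sUnion fun A hA => (hc hA).1,
    Set.sUnion_subset fun A hA => (hc hA).2⟩, fun A hA => Set.subset_sUnion_of_mem hA⟩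

lemma IsMaxConvex.isClosed {C : Set ((E d) × ℝ)} (hC : IsMaxConvex S C) : IsClosed C := by
  have h := hC.eq_of_subset hC.convex.closure
    (closure_minimal hC.subset isClosed_quadEpigraph) subset_closure
  rw [h]
  exact isClosed_closure

/-- A maximal convex set contains every point `(w, c)` of the epigraph of `½ S(y, y)` whose height
`c` is at least the `S`-conjugate of the convex set at `w`: the convex join of such a point with
the set stays in the epigraph. -/
lemma IsMaxConvex.mem_of_conjugate_le {m : ℕ} (hS : IsSymWithIndex d m S) {C : Set ((E d) × ℝ)}
    (hC : IsMaxConvex S C) (hne : C.Nonempty) {w : E d} {c : ℝ}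
    (hw : 1 / 2 * sProd S w w ≤ c) (hconj : ∀ p ∈ C, sProd S w p.1 - p.2 ≤ c) : (w, c) ∈ C := by
  have hsub : convexHull ℝ (insert (w, c) C) ⊆ quadEpigraph S := by
    rw [convexHull_insert hne, hC.convex.convexHull_eq]
    intro x hx
    simp only [mem_convexJoin, Set.mem_singleton_iff, exists_eq_left] at hx
    obtain ⟨⟨u, s⟩, hu, a, b, ha, hb, hab, rfl⟩ := hx
    have h1 := mem_quadEpigraph.mp (hC.subset hu)
    dsimp only at h1
    have h2 := hconj _ hu
    simp only [quadEpigraph, Set.mem_ofPred_eq, Prod.smul_mk, Prod.mk_add_mk, sProd_add_left,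
      sProd_add_right, sProd_smul_left, sProd_smul_right, smul_eq_mul, hS.sProd_comm u w]
    have hid : a * c + b * s - 1 / 2 * (a * (a * sProd S w w) + b * (a * sProd S w u)
        + (a * (b * sProd S w u) + b * (b * sProd S u u)))
        = a * a * (c - 1 / 2 * sProd S w w) + b * b * (s - 1 / 2 * sProd S u u)
          + a * b * (c - (sProd S w u - s)) := by
      obtain rfl : b = 1 - a := by linarith
      ring
    have p1 := mul_nonneg (mul_nonneg ha ha) (sub_nonneg.mpr hw)
    have p2 := mul_nonneg (mul_nonneg hb hb) (sub_nonneg.mpr h1)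
    have p3 := mul_nonneg (mul_nonneg ha hb) (sub_nonneg.mpr h2)
    dsimp only at p3
    linarith
  have h := hC.eq_of_subset (convex_convexHull ℝ _) hsub
    ((Set.subset_insert _ _).trans (subset_convexHull ℝ _))
  rw [h]
  exact subset_convexHull ℝ _ (Set.mem_insert _ _)

lemma nonneg_of_forall_mul_le {a b : ℝ} (h : ∀ t : ℝ, 0 < t → t ≤ 1 → t * b ≤ a) : 0 ≤ a := by
  by_contra! ha
  have h1 := h 1 one_pos le_rfl
  have hb : b < 0 := by linarith
  have := h (a / (2 * b)) (by apply div_pos_of_neg_of_neg <;> linarith)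
    (by rw [div_le_one_of_neg (by linarith)]; linarith)
  rw [div_mul_eq_mul_div, mul_div_mul_right _ _ hb.ne] at this
  linarith

/-- At a contact point, the tangent of `½ S(y, y)` supports the convex set from below. -/
lemma le_of_mem_contactSet {m : ℕ} (hS : IsSymWithIndex d m S) {C : Set ((E d) × ℝ)}
    (hC : Convex ℝ C) (hCS : C ⊆ quadEpigraph S) {z : E d} (hz : z ∈ contactSet S C)
    {p : (E d) × ℝ} (hp : p ∈ C) : sProd S z p.1 - 1 / 2 * sProd S z z ≤ p.2 := by
  obtain ⟨v, s⟩ := p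
  suffices 0 ≤ s - (sProd S z v - 1 / 2 * sProd S z z) by linarith
  refine nonneg_of_forall_mul_le (b := 1 / 2 * sProd S (v - z) (v - z)) fun t ht0 ht1 => ?_
  have h := hCS (hC hz hp (sub_nonneg.mpr ht1) ht0.le (by ring))
  simp only [quadEpigraph, Set.mem_ofPred_eq, Prod.smul_mk, Prod.mk_add_mk, sProd_add_left,
      sProd_add_right, sProd_sub_left, sProd_sub_right, sProd_smul_left, sProd_smul_right,
      smul_eq_mul, hS.sProd_comm v z] at h ⊢
  refine le_of_mul_le_mul_left ?_ ht0
  linarith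

lemma sMonotone_contactSet {m : ℕ} (hS : IsSymWithIndex d m S) {C : Set ((E d) × ℝ)}
    (hC : Convex ℝ C) (hCS : C ⊆ quadEpigraph S) : SMonotone S (contactSet S C) := by
  intro x hx y hy
  have h := le_of_mem_contactSet hS hC hCS hx hy
  simp only [sProd_sub_left, sProd_sub_right, hS.sProd_comm y x] at h ⊢
  linarith

/-- A nonempty closed convex set `C` above the graph of `½ S(y, y)` has a point that minimizes
`t - S(z, v) + ½ S(z, z) + ½ S(J(v - z), v - z)`. The function is nonnegative and strongly convex
in `v`, so its sublevel sets in `C` are compact. -/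
lemma exists_isMinOn_penalized {m : ℕ} (hS : IsSymWithIndex d m S) {J : (E d) →ₗ[ℝ] (E d)} {c : ℝ}
    (hJ : IsSignOperator S J c) {C : Set ((E d) × ℝ)} (hC : Convex ℝ C)
    (hCS : C ⊆ quadEpigraph S) (hcl : IsClosed C) (hne : C.Nonempty) (z : E d) :
    ∃ p ∈ C, IsMinOn (fun p : (E d) × ℝ => p.2 - sProd S z p.1 + 1 / 2 * sProd S z z
      + 1 / 2 * sProd S (J (p.1 - z)) (p.1 - z)) C p := by
  set Φ : (E d) × ℝ → ℝ := fun p => p.2 - sProd S z p.1 + 1 / 2 * sProd S z z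
      + 1 / 2 * sProd S (J (p.1 - z)) (p.1 - z) with hΦ
  have hJc : Continuous J := LinearMap.continuous_of_finiteDimensional _
  have hΦc : Continuous Φ := by fun_prop
  have hpos : ∀ p ∈ C, 0 ≤ Φ p := by
    intro p hp
    have h1 : 1 / 2 * sProd S p.1 p.1 ≤ p.2 := mem_quadEpigraph.mp (hCS hp)
    have h2 := hJ.dominates (p.1 - z)
    have h3 : sProd S (p.1 - z) (p.1 - z)
        = sProd S p.1 p.1 - 2 * sProd S z p.1 + sProd S z z := by
      simp only [sProd_sub_left, sProd_sub_right, hS.sProd_comm p.1 z]; ring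
    simp only [hΦ]
    linarith
  obtain ⟨p₀, hp₀⟩ := hne
  obtain ⟨A, hA, hAle⟩ := exists_abs_sProd_le S
  -- the parallelogram identity for the strongly convex part bounds the sublevel set
  have hbound : ∀ p ∈ C, Φ p ≤ Φ p₀ → ‖p.1 - p₀.1‖ ^ 2 ≤ 8 * Φ p₀ / c := by
    intro p hp hle
    have hmid := hpos _ (hC hp hp₀ (by norm_num : (0 : ℝ) ≤ 1 / 2) (by norm_num : (0 : ℝ) ≤ 1 / 2)
      (by norm_num))
    have hid : Φ ((1 / 2 : ℝ) • p + (1 / 2 : ℝ) • p₀) = 1 / 2 * Φ p + 1 / 2 * Φ p₀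
        - 1 / 8 * sProd S (J (p.1 - p₀.1)) (p.1 - p₀.1) := by
      simp only [hΦ, Prod.fst_add, Prod.snd_add, Prod.smul_fst, Prod.smul_snd, map_add, map_sub,
        map_smul, sProd_add_left, sProd_add_right, sProd_sub_left, sProd_sub_right,
        sProd_smul_left, sProd_smul_right, smul_eq_mul]
      ring
    have hco := hJ.coercive (p.1 - p₀.1)
    rw [le_div_iff₀ hJ.pos]
    linarith
  set R := ‖p₀.1‖ + (8 * Φ p₀ / c + 1) with hR
  have hnorm : ∀ p ∈ C, Φ p ≤ Φ p₀ → ‖p.1‖ ≤ R := by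
    intro p hp hle
    have h1 := hbound p hp hle
    have h2 : ‖p.1‖ ≤ ‖p₀.1‖ + ‖p.1 - p₀.1‖ := by
      calc ‖p.1‖ = ‖p₀.1 + (p.1 - p₀.1)‖ := by congr 1; abel
        _ ≤ _ := norm_add_le _ _
    nlinarith [sq_nonneg (‖p.1 - p₀.1‖ - 1), norm_nonneg (p.1 - p₀.1)]
  have hcomp : IsCompact (C ∩ {p | Φ p ≤ Φ p₀}) := by
    refine IsCompact.of_isClosed_subset ((isCompact_closedBall (0 : E d) R).prod
      (isCompact_Icc (a := -(A * R * R)) (b := Φ p₀ + A * ‖z‖ * R + A * ‖z‖ * ‖z‖)))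
      (hcl.inter (isClosed_le hΦc continuous_const)) ?_
    rintro p ⟨hp, hle⟩
    have hn := hnorm p hp hle
    have h1 : 1 / 2 * sProd S p.1 p.1 ≤ p.2 := mem_quadEpigraph.mp (hCS hp)
    have h2 := (abs_le.mp (hAle p.1 p.1)).1
    have h3 := (abs_le.mp (hAle z p.1)).2
    have h4 := (abs_le.mp (hAle z z)).1
    have h5 : 0 ≤ sProd S (J (p.1 - z)) (p.1 - z) :=
      le_trans (mul_nonneg hJ.pos.le (sq_nonneg _)) (hJ.coercive _)
    have hR0 : 0 ≤ R := (norm_nonneg _).trans hn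
    have h6 : A * ‖p.1‖ * ‖p.1‖ ≤ A * R * R := by gcongr
    have h7 : A * ‖z‖ * ‖p.1‖ ≤ A * ‖z‖ * R := by gcongr
    have h8 : 0 ≤ A * ‖z‖ * ‖z‖ := by positivity
    have h9 : 0 ≤ A * ‖p.1‖ * ‖p.1‖ := by positivity
    have hle' : p.2 - sProd S z p.1 + 1 / 2 * sProd S z z
      + 1 / 2 * sProd S (J (p.1 - z)) (p.1 - z) ≤ Φ p₀ := hle
    refine ⟨by simpa using hn, ?_, ?_⟩ <;> linarith
  obtain ⟨p, ⟨hp, hle⟩, hmin⟩ :=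
    hcomp.exists_isMinOn ⟨p₀, hp₀, le_refl (Φ p₀)⟩ hΦc.continuousOn
  refine ⟨p, hp, fun x hx => ?_⟩
  rcases le_total (Φ x) (Φ p₀) with h | h
  · exact hmin ⟨hx, h⟩
  · exact le_trans hle h

/-- The contact set of a maximal convex set is maximal `S`-monotone. -/
lemma IsMaxConvex.maximalSMonotone_contactSet {m : ℕ} (hS : IsSymWithIndex d m S)
    {C : Set ((E d) × ℝ)} (hC : IsMaxConvex S C) (hne : C.Nonempty) :
    MaximalSMonotone S (contactSet S C) := by
  refine ⟨sMonotone_contactSet hS hC.convex hC.subset, fun H hH hlt => ?_⟩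
  obtain ⟨z, hzH, hz⟩ := Set.exists_of_ssubset hlt
  refine hz ?_
  obtain ⟨J, c, hJ⟩ := hS.exists_isSignOperator
  obtain ⟨⟨v, t⟩, hvt, hmin⟩ :=
    exists_isMinOn_penalized hS hJ hC.convex hC.subset hC.isClosed hne z
  have hsymm : ∀ a b, sProd S (J a) b = sProd S (J b) a := fun a b => by
    rw [hJ.symm, hS.sProd_comm]
  -- first-order condition at the minimizer
  have hfirst : ∀ p ∈ C, 0 ≤ p.2 - t - sProd S z (p.1 - v) + sProd S (J (v - z)) (p.1 - v) := by
    rintro ⟨u, s⟩ hp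
    refine nonneg_of_forall_mul_le (b := -(1 / 2 * sProd S (J (u - v)) (u - v)))
      fun τ hτ0 hτ1 => ?_
    have h := hmin (hC.convex hvt hp (sub_nonneg.mpr hτ1) hτ0.le (by ring))
    simp only [Set.mem_ofPred_eq, Prod.smul_mk, Prod.mk_add_mk, smul_eq_mul] at h
    have e1 : (1 - τ) • v + τ • u - z = (v - z) + τ • (u - v) := by module
    have e2 : (1 - τ) • v + τ • u = v + τ • (u - v) := by module
    rw [e1, e2] at h
    simp only [map_add, map_smul, sProd_add_left, sProd_add_right, sProd_smul_left,
      sProd_smul_right, hsymm (u - v) (v - z)] at h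
    refine le_of_mul_le_mul_left ?_ hτ0
    dsimp only
    linarith
  have ht := mem_quadEpigraph.mp (hC.subset hvt)
  dsimp only at ht
  obtain ⟨p, rfl⟩ : ∃ p, v = z + p := ⟨v - z, by abel⟩
  rw [add_sub_cancel_left] at hfirst
  have hdom := hJ.dominates p
  have hiso := hJ.isometry p
  -- the reflected point `w = z - J p` is a contact point
  have hw : z - J p ∈ contactSet S C := by
    refine hC.mem_of_conjugate_le hS hne le_rfl fun q hq => ?_
    have h := hfirst q hq
    have e := hS.sProd_comm (J p) z
    have e' := hS.sProd_comm p z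
    simp only [sProd_sub_left, sProd_sub_right, sProd_add_left, sProd_add_right] at h ht ⊢
    linarith
  have hmono := hH z hzH _ (hlt.subset hw)
  have hback := hfirst _ hw
  have hpos : 0 ≤ sProd S p p := by
    rw [← hiso]; simpa using hmono
  have hco := hJ.coercive p
  have hp0 : ‖p‖ ^ 2 ≤ 0 := by
    have e := hS.sProd_comm (J p) z
    have e' := hS.sProd_comm p z
    simp only [sProd_sub_left, sProd_sub_right, sProd_add_left, sProd_add_right] at hback ht
    have : c * ‖p‖ ^ 2 ≤ 0 := by linarith
    by_contra! h
    exact absurd this (not_le.mpr (mul_pos hJ.pos h))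
  have hp0' : p = 0 := by
    rw [← norm_eq_zero]
    exact pow_eq_zero_iff (two_ne_zero) |>.mp (le_antisymm hp0 (sq_nonneg _))
  rw [hp0', map_zero, sub_zero] at hw
  exact hw

/-! ### Integration of `S(x, y)` -/

lemma aestronglyMeasurable_sProd {Ω : Type*} [MeasurableSpace Ω] {μ : Measure Ω} {f g : Ω → E d}
    (hf : AEStronglyMeasurable f μ) (hg : AEStronglyMeasurable g μ) :
    AEStronglyMeasurable (fun ω => sProd S (f ω) (g ω)) μ := by
  have h : Continuous (Matrix.toEuclideanLin S) := LinearMap.continuous_of_finiteDimensional _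
  exact hf.inner (h.comp_aestronglyMeasurable hg)

lemma integrable_sProd {Ω : Type*} [MeasurableSpace Ω] {μ : Measure Ω} {f g : Ω → E d}
    (hf : MemLp f 2 μ) (hg : MemLp g 2 μ) : Integrable (fun ω => sProd S (f ω) (g ω)) μ := by
  obtain ⟨A, hA, hAle⟩ := exists_abs_sProd_le S
  refine ((hf.norm.integrable_mul hg.norm).const_mul A).mono
    (aestronglyMeasurable_sProd hf.1 hg.1) (Eventually.of_forall fun ω => ?_)
  rw [Real.norm_eq_abs]
  refine (hAle _ _).trans (le_of_eq ?_)
  simp only [Pi.mul_apply, norm_mul, norm_norm, Real.norm_of_nonneg hA]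
  ring

lemma integrable_sProd_const {Ω : Type*} [MeasurableSpace Ω] {μ : Measure Ω} {f : Ω → E d}
    (hf : Integrable f μ) (c : E d) : Integrable (fun ω => sProd S c (f ω)) μ :=
  ((innerSL ℝ c).comp
    (LinearMap.toContinuousLinearMap (Matrix.toEuclideanLin S))).integrable_comp hf

lemma integral_sProd_const {Ω : Type*} [MeasurableSpace Ω] {μ : Measure Ω} {f : Ω → E d}
    (hf : Integrable f μ) (c : E d) : ∫ ω, sProd S c (f ω) ∂μ = sProd S c (∫ ω, f ω ∂μ) :=
  ((innerSL ℝ c).comp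
    (LinearMap.toContinuousLinearMap (Matrix.toEuclideanLin S))).integral_comp_comm hf

/-! ### Backward martingale plans and their disintegrations -/

section Plan

variable {ν : Measure (E d)} {γ : Measure ((E d) × (E d))}

lemma IsPlan.memLp_fst (hγ : IsPlan ν γ) : MemLp (fun p => p.1) 2 γ := hγ.memLp_two.fst

lemma IsPlan.memLp_snd (hγ : IsPlan ν γ) : MemLp (fun p => p.2) 2 γ := hγ.memLp_two.snd

lemma IsPlan.integrable_snd (hγ : IsPlan ν γ) : Integrable (fun p => p.2) γ :=
  have := hγ.isProbabilityMeasure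
  hγ.memLp_snd.integrable (by norm_num)

lemma IsPlan.memLp_id_fst (hγ : IsPlan ν γ) : MemLp (fun x => x) 2 γ.fst :=
  (memLp_map_measure_iff (by fun_prop) (by fun_prop)).mpr hγ.memLp_fst

/-- The conditional mean of the second coordinate given the first one is the first one. -/
lemma IsPlan.ae_mean [IsProbabilityMeasure γ] (hγ : IsPlan ν γ) :
    ∀ᵐ x ∂γ.fst, Integrable (fun y => y) (γ.condKernel x) ∧ ∫ y, y ∂γ.condKernel x = x := by
  have h1 := hγ.integrable_snd.condKernel_ae
  have h2 := ProbabilityTheory.condExp_ae_eq_integral_condDistrib' (μ := γ) (X := Prod.fst)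
    measurable_fst hγ.integrable_snd
  have h3 := h2.symm.trans hγ.condExp_snd
  have hcd : ProbabilityTheory.condDistrib Prod.snd Prod.fst γ = γ.condKernel := by
    rw [ProbabilityTheory.condDistrib]
    simp
  rw [hcd] at h3
  have h4 : ∀ᵐ x ∂γ.fst, ∫ y, y ∂γ.condKernel x = x := by
    refine (ae_map_iff measurable_fst.aemeasurable ?_).mpr h3
    exact measurableSet_eq_fun
      (StronglyMeasurable.integral_kernel (f := fun y : E d => y)
        measurable_id.stronglyMeasurable).measurable measurable_id
  filter_upwards [h1, h4] with x hx1 hx2 using ⟨hx1, hx2⟩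

lemma ae_of_ae_fst {P : (E d) → Prop} (h : ∀ᵐ x ∂γ.fst, P x) : ∀ᵐ p ∂γ, P p.1 :=
  ae_of_ae_map measurable_fst.aemeasurable h

lemma integral_fst_eq {F : Type*} [NormedAddCommGroup F] [NormedSpace ℝ F] {f : (E d) → F}
    (hf : AEStronglyMeasurable f γ.fst) : ∫ x, f x ∂γ.fst = ∫ p, f p.1 ∂γ :=
  integral_map measurable_fst.aemeasurable hf

lemma IsPlan.integral_sProd_fst_snd (hγ : IsPlan ν γ) :
    ∫ p, sProd S p.1 p.2 ∂γ = ∫ p, sProd S p.1 p.1 ∂γ := by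
  have := hγ.isProbabilityMeasure
  rw [← Measure.integral_condKernel (integrable_sProd hγ.memLp_fst hγ.memLp_snd),
    ← integral_fst_eq (f := fun x => sProd S x x)
      (by exact (continuous_sProd continuous_id continuous_id).aestronglyMeasurable)]
  refine integral_congr_ae ?_
  filter_upwards [hγ.ae_mean] with x hx
  rw [integral_sProd_const hx.1, hx.2]

/-- A probability measure with the right second marginal is a plan as soon as `y - x` has zero
integral over all sets of the form `{x ∈ A}`. -/
lemma IsPlan.of_setIntegral [IsProbabilityMeasure γ] (h2 : MemLp (fun p => p) 2 γ)
    (hsnd : γ.map Prod.snd = ν)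
    (h : ∀ A : Set (E d), MeasurableSet A → ∫ p in Prod.fst ⁻¹' A, (p.2 - p.1) ∂γ = 0) :
    IsPlan ν γ := by
  have i1 : Integrable (fun p => p.1) γ := h2.fst.integrable (by norm_num)
  have i2 : Integrable (fun p => p.2) γ := h2.snd.integrable (by norm_num)
  refine ⟨inferInstance, h2, hsnd, EventuallyEq.symm ?_⟩
  refine ae_eq_condExp_of_forall_setIntegral_eq measurable_fst.comap_le i2
    (fun s _ _ => i1.integrableOn) ?_ (comap_measurable _).aestronglyMeasurable
  rintro _ ⟨A, hA, rfl⟩ _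
  have := h A hA
  rw [integral_sub i2.integrableOn i1.integrableOn] at this
  exact (sub_eq_zero.mp this).symm

/-- The plan obtained from a splitting `γ₁ + γ₂` of `γ` by moving the first coordinate to `T x`
under `γ₁` and to the constant `c` under `γ₂`. -/
noncomputable def reroute (γ₁ γ₂ : Measure ((E d) × (E d))) (T : (E d) → (E d)) (c : E d) :
    Measure ((E d) × (E d)) :=
  γ₁.map (fun p => (T p.1, p.2)) + γ₂.map (fun p => (c, p.2))

lemma integral_reroute {γ₁ γ₂ : Measure ((E d) × (E d))} {T : (E d) → (E d)} (hT : Measurable T)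
    (c : E d) {F : Type*} [NormedAddCommGroup F] [NormedSpace ℝ F] {f : (E d) × (E d) → F}
    (hf : StronglyMeasurable f) (h1 : Integrable (fun p => f (T p.1, p.2)) γ₁)
    (h2 : Integrable (fun p => f (c, p.2)) γ₂) :
    Integrable f (reroute γ₁ γ₂ T c) ∧
    ∫ p, f p ∂reroute γ₁ γ₂ T c = ∫ p, f (T p.1, p.2) ∂γ₁ + ∫ p, f (c, p.2) ∂γ₂ := by
  have m1 : Measurable fun p : (E d) × (E d) => (T p.1, p.2) := by fun_prop
  have m2 : Measurable fun p : (E d) × (E d) => (c, p.2) := by fun_prop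
  have i1 : Integrable f (γ₁.map fun p => (T p.1, p.2)) :=
    (integrable_map_measure hf.aestronglyMeasurable m1.aemeasurable).mpr h1
  have i2 : Integrable f (γ₂.map fun p => (c, p.2)) :=
    (integrable_map_measure hf.aestronglyMeasurable m2.aemeasurable).mpr h2
  refine ⟨i1.add_measure i2, ?_⟩
  rw [reroute, integral_add_measure i1 i2, integral_map m1.aemeasurable hf.aestronglyMeasurable,
    integral_map m2.aemeasurable hf.aestronglyMeasurable]

lemma IsPlan.reroute (hγ : IsPlan ν γ) {γ₁ γ₂ : Measure ((E d) × (E d))} (hadd : γ₁ + γ₂ = γ)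
    {T : (E d) → (E d)} (hT : Measurable T) (hT2 : MemLp (fun p => T p.1) 2 γ) (c : E d)
    (h1 : ∀ A : Set (E d), MeasurableSet A → ∫ p in {p | T p.1 ∈ A}, (p.2 - T p.1) ∂γ₁ = 0)
    (h2 : ∫ p, (p.2 - c) ∂γ₂ = 0) : IsPlan ν (reroute γ₁ γ₂ T c) := by
  have := hγ.isProbabilityMeasure
  have l1 : γ₁ ≤ γ := hadd ▸ Measure.le_add_right le_rfl
  have l2 : γ₂ ≤ γ := hadd ▸ Measure.le_add_left le_rfl
  have : IsFiniteMeasure γ₁ := isFiniteMeasure_of_le γ l1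
  have : IsFiniteMeasure γ₂ := isFiniteMeasure_of_le γ l2
  have m1 : Measurable fun p : (E d) × (E d) => (T p.1, p.2) := by fun_prop
  have m2 : Measurable fun p : (E d) × (E d) => (c, p.2) := by fun_prop
  have L1 : MemLp (fun p => (T p.1, p.2)) 2 γ₁ :=
    (MemLp.of_fst_snd ⟨hT2, hγ.memLp_snd⟩ : MemLp (fun p => (T p.1, p.2)) 2 γ).mono_measure l1
  have L2 : MemLp (fun p => (c, p.2)) 2 γ₂ :=
    (MemLp.of_fst_snd ⟨memLp_const c, hγ.memLp_snd⟩ :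
      MemLp (fun p => (c, p.2)) 2 γ).mono_measure l2
  have hprob : IsProbabilityMeasure (BackwardTransport.reroute γ₁ γ₂ T c) := by
    constructor
    rw [BackwardTransport.reroute, Measure.add_apply, Measure.map_apply m1 .univ,
      Measure.map_apply m2 .univ, Set.preimage_univ, Set.preimage_univ, ← Measure.add_apply, hadd]
    exact measure_univ
  refine IsPlan.of_setIntegral ?_ ?_ fun A hA => ?_
  · rw [memLp_two_iff_integrable_sq_norm (by fun_prop)]
    refine (integral_reroute hT c (by fun_prop) ?_ ?_).1
    · exact (memLp_two_iff_integrable_sq_norm L1.1).mp L1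
    · exact (memLp_two_iff_integrable_sq_norm L2.1).mp L2
  · rw [BackwardTransport.reroute, Measure.map_add _ _ measurable_snd,
      Measure.map_map measurable_snd m1, Measure.map_map measurable_snd m2, ← hγ.map_snd, ← hadd,
      Measure.map_add _ _ measurable_snd]
    rfl
  · have j1 : Integrable (fun p => p.2 - T p.1) γ₁ :=
      (L1.snd.integrable (by norm_num)).sub (L1.fst.integrable (by norm_num))
    have j2 : Integrable (fun p => p.2 - c) γ₂ :=
      (L2.snd.integrable (by norm_num)).sub (L2.fst.integrable (by norm_num))
    have hA1 : MeasurableSet {p : (E d) × (E d) | T p.1 ∈ A} := (hT.comp measurable_fst) hA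
    rw [← integral_indicator (measurable_fst hA)]
    rw [(integral_reroute hT c (StronglyMeasurable.indicator (by fun_prop)
      (measurable_fst hA)) (f := Set.indicator (Prod.fst ⁻¹' A) fun p => p.2 - p.1)
      (j1.indicator hA1) ?_).2]
    · have e1 : ∫ p, Set.indicator (Prod.fst ⁻¹' A) (fun p : (E d) × (E d) => p.2 - p.1)
          (T p.1, p.2) ∂γ₁ = 0 := by
        rw [← h1 A hA, ← integral_indicator hA1]; rfl
      rw [e1, zero_add]
      by_cases hc : c ∈ A
      · rw [← h2]
        refine integral_congr_ae (Eventually.of_forall fun p => ?_)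
        simp [Set.indicator, hc]
      · simp [Set.indicator, hc]
    · by_cases hc : c ∈ A
      · refine j2.congr (Eventually.of_forall fun p => ?_)
        simp [Set.indicator, hc]
      · simp [Set.indicator, hc]

end Plan

section Perturbation

variable {ν : Measure (E d)} {γ : Measure ((E d) × (E d))}

/-! ### First-order optimality of a plan -/

/-- `θ` is a probability density with respect to `γ` such that `θ` and `θ(x, y) y` are bounded
by `M`. -/
structure IsTilt (γ : Measure ((E d) × (E d))) (θ : (E d) × (E d) → ℝ) (M : ℝ) : Prop where
  pos : 0 < M
  measurable : Measurable θ
  nonneg : ∀ p, 0 ≤ θ p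
  le : ∀ p, θ p ≤ M
  norm_smul_le : ∀ p, ‖θ p • p.2‖ ≤ M
  integral_eq_one : ∫ p, θ p ∂γ = 1

/-- The conditional mean of `θ` given `x`. -/
noncomputable def condMass (γ : Measure ((E d) × (E d))) [IsFiniteMeasure γ]
    (θ : (E d) × (E d) → ℝ) (x : E d) : ℝ := ∫ y, θ (x, y) ∂γ.condKernel x

/-- The conditional mean of `θ(x, y) y` given `x`. -/
noncomputable def condMoment (γ : Measure ((E d) × (E d))) [IsFiniteMeasure γ]
    (θ : (E d) × (E d) → ℝ) (x : E d) : E d := ∫ y, θ (x, y) • y ∂γ.condKernel x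

/-- The conditional mean of `y` given `x` after removal of the mass `ε θ`. -/
noncomputable def shiftedMean (γ : Measure ((E d) × (E d))) [IsFiniteMeasure γ]
    (θ : (E d) × (E d) → ℝ) (ε : ℝ) (x : E d) : E d :=
  (1 - ε * condMass γ θ x)⁻¹ • (x - ε • condMoment γ θ x)

lemma integral_withDensity_ofReal {Ω F : Type*} [MeasurableSpace Ω] {μ : Measure Ω}
    [NormedAddCommGroup F] [NormedSpace ℝ F] {w : Ω → ℝ} (hw : Measurable w) (h0 : ∀ ω, 0 ≤ w ω)
    (g : Ω → F) :
    ∫ ω, g ω ∂μ.withDensity (fun ω => ENNReal.ofReal (w ω)) = ∫ ω, w ω • g ω ∂μ := by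
  rw [integral_withDensity_eq_integral_toReal_smul hw.ennreal_ofReal
    (Eventually.of_forall fun _ => ENNReal.ofReal_lt_top)]
  simp only [ENNReal.toReal_ofReal (h0 _)]

variable {θ : (E d) × (E d) → ℝ} {M ε : ℝ}

lemma IsTilt.abs_le (hθ : IsTilt γ θ M) (p : (E d) × (E d)) : ‖θ p‖ ≤ M := by
  rw [Real.norm_of_nonneg (hθ.nonneg p)]
  exact hθ.le p

lemma IsTilt.one_sub_nonneg (hθ : IsTilt γ θ M) (hε : 0 < ε) (hεM : ε * M ≤ 1 / 2)
    (p : (E d) × (E d)) : 0 ≤ 1 - ε * θ p := by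
  have := mul_le_mul_of_nonneg_left (hθ.le p) hε.le
  linarith

lemma IsTilt.norm_one_sub_le (hθ : IsTilt γ θ M) (hε : 0 < ε) (hεM : ε * M ≤ 1 / 2)
    (p : (E d) × (E d)) : ‖1 - ε * θ p‖ ≤ 1 := by
  rw [Real.norm_of_nonneg (hθ.one_sub_nonneg hε hεM p)]
  have := mul_nonneg hε.le (hθ.nonneg p)
  linarith

lemma IsTilt.withDensity_add (hθ : IsTilt γ θ M) (hε : 0 < ε) (hεM : ε * M ≤ 1 / 2) :
    (γ.withDensity fun p => ENNReal.ofReal (1 - ε * θ p))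
      + (γ.withDensity fun p => ENNReal.ofReal (ε * θ p)) = γ := by
  have hm := hθ.measurable
  rw [← withDensity_add_left (by fun_prop)]
  conv_rhs => rw [← withDensity_one (μ := γ)]
  congr 1
  funext p
  rw [Pi.add_apply, ← ENNReal.ofReal_add (hθ.one_sub_nonneg hε hεM p)
    (mul_nonneg hε.le (hθ.nonneg p))]
  simp

section Finite

variable [IsProbabilityMeasure γ]

lemma IsTilt.measurable_condMass (hθ : IsTilt γ θ M) : Measurable (condMass γ θ) :=
  (StronglyMeasurable.integral_kernel_prod_right' (κ := γ.condKernel)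
    hθ.measurable.stronglyMeasurable).measurable

lemma IsTilt.measurable_condMoment (hθ : IsTilt γ θ M) : Measurable (condMoment γ θ) :=
  (StronglyMeasurable.integral_kernel_prod_right' (κ := γ.condKernel)
    (hθ.measurable.smul measurable_snd).stronglyMeasurable).measurable

lemma IsTilt.condMass_nonneg (hθ : IsTilt γ θ M) (x : E d) : 0 ≤ condMass γ θ x :=
  integral_nonneg fun _ => hθ.nonneg _

lemma IsTilt.condMass_le (hθ : IsTilt γ θ M) (x : E d) : condMass γ θ x ≤ M := by
  have h := norm_integral_le_of_norm_le_const (μ := γ.condKernel x) (f := fun y => θ (x, y))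
    (C := M) (Eventually.of_forall fun y => hθ.abs_le (x, y))
  rw [probReal_univ, mul_one] at h
  exact (le_abs_self _).trans h

lemma IsTilt.norm_condMoment_le (hθ : IsTilt γ θ M) (x : E d) : ‖condMoment γ θ x‖ ≤ M := by
  have h := norm_integral_le_of_norm_le_const (μ := γ.condKernel x)
    (f := fun y => θ (x, y) • y) (C := M) (Eventually.of_forall fun y => hθ.norm_smul_le (x, y))
  rwa [probReal_univ, mul_one] at h

lemma IsTilt.half_le (hθ : IsTilt γ θ M) (hε : 0 < ε) (hεM : ε * M ≤ 1 / 2) (x : E d) :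
    1 / 2 ≤ 1 - ε * condMass γ θ x := by
  have := mul_le_mul_of_nonneg_left (hθ.condMass_le x) hε.le
  linarith

lemma IsTilt.measurable_shiftedMean (hθ : IsTilt γ θ M) : Measurable (shiftedMean γ θ ε) := by
  have h1 := hθ.measurable_condMass
  have h2 := hθ.measurable_condMoment
  unfold shiftedMean
  fun_prop

lemma IsTilt.smul_shiftedMean (hθ : IsTilt γ θ M) (hε : 0 < ε) (hεM : ε * M ≤ 1 / 2) (x : E d) :
    (1 - ε * condMass γ θ x) • shiftedMean γ θ ε x = x - ε • condMoment γ θ x := by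
  have := hθ.half_le hε hεM x
  rw [shiftedMean, smul_inv_smul₀ (by linarith)]

lemma IsTilt.memLp_condMoment (hθ : IsTilt γ θ M) : MemLp (condMoment γ θ) 2 γ.fst :=
  MemLp.of_bound hθ.measurable_condMoment.aestronglyMeasurable M
    (Eventually.of_forall hθ.norm_condMoment_le)

lemma IsTilt.memLp_shiftedMean (hγ : IsPlan ν γ) (hθ : IsTilt γ θ M) (hε : 0 < ε)
    (hεM : ε * M ≤ 1 / 2) : MemLp (shiftedMean γ θ ε) 2 γ.fst := by
  refine (hγ.memLp_id_fst.sub (hθ.memLp_condMoment.const_smul ε)).of_le_mul (c := 2)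
    hθ.measurable_shiftedMean.aestronglyMeasurable (Eventually.of_forall fun x => ?_)
  have h := hθ.half_le hε hεM x
  have hpos : 0 < 1 - ε * condMass γ θ x := by linarith
  rw [shiftedMean, norm_smul, norm_inv, Real.norm_of_nonneg hpos.le]
  refine mul_le_mul_of_nonneg_right ?_ (norm_nonneg _)
  rw [inv_le_comm₀ hpos two_pos]
  linarith

/-- Conditional integral of `(1 - ε θ(x, y)) (y - t)` given `x`. -/
lemma IsTilt.integral_condKernel_sub (hθ : IsTilt γ θ M) {x : E d}
    (hx : Integrable (fun y => y) (γ.condKernel x) ∧ ∫ y, y ∂γ.condKernel x = x) (t : E d) :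
    Integrable (fun y => (1 - ε * θ (x, y)) • (y - t)) (γ.condKernel x) ∧
    ∫ y, (1 - ε * θ (x, y)) • (y - t) ∂γ.condKernel x
      = x - ε • condMoment γ θ x - (1 - ε * condMass γ θ x) • t := by
  have m1 : Measurable fun y => θ (x, y) := hθ.measurable.comp measurable_prodMk_left
  have i1 : Integrable (fun y => θ (x, y)) (γ.condKernel x) :=
    Integrable.of_bound m1.aestronglyMeasurable M (Eventually.of_forall fun y => hθ.abs_le _)
  have i2 : Integrable (fun y => θ (x, y) • y) (γ.condKernel x) :=
    Integrable.of_bound (m1.smul measurable_id).aestronglyMeasurable M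
      (Eventually.of_forall fun y => hθ.norm_smul_le (x, y))
  have e : (fun y => (1 - ε * θ (x, y)) • (y - t))
      = fun y => (y - ε • (θ (x, y) • y)) - (1 - ε * θ (x, y)) • t := by
    funext y
    module
  have i3 : Integrable (fun y => y - ε • (θ (x, y) • y)) (γ.condKernel x) :=
    hx.1.sub (i2.smul ε)
  have i4 : Integrable (fun y => (1 - ε * θ (x, y)) • t) (γ.condKernel x) :=
    ((integrable_const (1 : ℝ)).sub (i1.const_mul ε)).smul_const t
  have i5 : Integrable (fun y => ε • (θ (x, y) • y)) (γ.condKernel x) := i2.smul ε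
  rw [e]
  refine ⟨i3.sub i4, ?_⟩
  rw [integral_sub i3 i4, integral_sub hx.1 i5, integral_smul, hx.2,
    integral_smul_const, integral_sub (integrable_const _) (i1.const_mul ε), integral_const_mul]
  simp [condMass, condMoment]

/-- The competitor of `γ` in the first-order argument: the mass `ε θ γ` is gathered at its mean,
and the first coordinate of the remaining mass is moved to the new conditional mean. -/
noncomputable def tiltedPlan (γ : Measure ((E d) × (E d))) [IsFiniteMeasure γ]
    (θ : (E d) × (E d) → ℝ) (ε : ℝ) : Measure ((E d) × (E d)) :=
  reroute (γ.withDensity fun p => ENNReal.ofReal (1 - ε * θ p))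
    (γ.withDensity fun p => ENNReal.ofReal (ε * θ p)) (shiftedMean γ θ ε) (∫ p, θ p • p.2 ∂γ)

lemma IsTilt.integrable (hθ : IsTilt γ θ M) : Integrable θ γ :=
  Integrable.of_bound hθ.measurable.aestronglyMeasurable M (Eventually.of_forall hθ.abs_le)

lemma IsTilt.memLp_smul_snd (hθ : IsTilt γ θ M) : MemLp (fun p => θ p • p.2) 2 γ :=
  MemLp.of_bound (hθ.measurable.smul measurable_snd).aestronglyMeasurable M
    (Eventually.of_forall hθ.norm_smul_le)

lemma IsTilt.integrable_smul_snd (hθ : IsTilt γ θ M) : Integrable (fun p => θ p • p.2) γ :=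
  hθ.memLp_smul_snd.integrable (by norm_num)

lemma IsTilt.isPlan_tiltedPlan (hγ : IsPlan ν γ) (hθ : IsTilt γ θ M) (hε : 0 < ε)
    (hεM : ε * M ≤ 1 / 2) : IsPlan ν (tiltedPlan γ θ ε) := by
  have hm := hθ.measurable
  have hT := hθ.measurable_shiftedMean (ε := ε)
  have hT2 : MemLp (fun p => shiftedMean γ θ ε p.1) 2 γ :=
    (memLp_map_measure_iff hT.aestronglyMeasurable measurable_fst.aemeasurable).mp
      (hθ.memLp_shiftedMean hγ hε hεM)
  refine hγ.reroute (hθ.withDensity_add hε hεM) hT hT2 _ (fun A hA => ?_) ?_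
  · have hA1 : MeasurableSet {p : (E d) × (E d) | shiftedMean γ θ ε p.1 ∈ A} :=
      (hT.comp measurable_fst) hA
    rw [← integral_indicator hA1, integral_withDensity_ofReal (by fun_prop)
      (hθ.one_sub_nonneg hε hεM)]
    have hint : Integrable (fun p => (1 - ε * θ p) • Set.indicator
        {p : (E d) × (E d) | shiftedMean γ θ ε p.1 ∈ A}
        (fun p => p.2 - shiftedMean γ θ ε p.1) p) γ := by
      exact (((hγ.memLp_snd.sub hT2).integrable (by norm_num)).indicator hA1).bdd_smul 1
        (Measurable.aestronglyMeasurable (by fun_prop))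
        (Eventually.of_forall (hθ.norm_one_sub_le hε hεM))
    rw [← Measure.integral_condKernel hint]
    refine integral_eq_zero_of_ae ?_
    filter_upwards [hγ.ae_mean] with x hx
    by_cases hxA : shiftedMean γ θ ε x ∈ A
    · have h := (hθ.integral_condKernel_sub (ε := ε) hx (shiftedMean γ θ ε x)).2
      rw [hθ.smul_shiftedMean hε hεM, sub_self] at h
      simpa [Set.indicator, hxA] using h
    · simp [Set.indicator, hxA]
  · rw [integral_withDensity_ofReal (by fun_prop) fun p => mul_nonneg hε.le (hθ.nonneg p)]
    have e : ∀ p : (E d) × (E d), (ε * θ p) • (p.2 - ∫ p, θ p • p.2 ∂γ)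
        = ε • (θ p • p.2 - θ p • ∫ p, θ p • p.2 ∂γ) := fun p => by module
    simp only [e]
    rw [integral_smul, integral_sub hθ.integrable_smul_snd (hθ.integrable.smul_const _),
      integral_smul_const, hθ.integral_eq_one, one_smul, sub_self, smul_zero]

lemma IsTilt.planValue_tiltedPlan (hγ : IsPlan ν γ) (hθ : IsTilt γ θ M) (hε : 0 < ε)
    (hεM : ε * M ≤ 1 / 2) :
    planValue S (tiltedPlan γ θ ε) =
      1 / 2 * (∫ x, sProd S (shiftedMean γ θ ε x) (x - ε • condMoment γ θ x) ∂γ.fst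
        + ε * sProd S (∫ p, θ p • p.2 ∂γ) (∫ p, θ p • p.2 ∂γ)) := by
  have hm := hθ.measurable
  have hT := hθ.measurable_shiftedMean (ε := ε)
  have hT2 : MemLp (fun p => shiftedMean γ θ ε p.1) 2 γ :=
    (memLp_map_measure_iff hT.aestronglyMeasurable measurable_fst.aemeasurable).mp
      (hθ.memLp_shiftedMean hγ hε hεM)
  have hadd := hθ.withDensity_add hε hεM
  have l1 : (γ.withDensity fun p => ENNReal.ofReal (1 - ε * θ p)) ≤ γ := by
    conv_rhs => rw [← hadd]
    exact Measure.le_add_right le_rfl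
  have l2 : (γ.withDensity fun p => ENNReal.ofReal (ε * θ p)) ≤ γ := by
    conv_rhs => rw [← hadd]
    exact Measure.le_add_left le_rfl
  have hc : Continuous fun p : (E d) × (E d) => sProd S p.1 p.2 := by fun_prop
  have j1 : Integrable (fun p => sProd S (shiftedMean γ θ ε p.1) p.2) γ :=
    integrable_sProd hT2 hγ.memLp_snd
  rw [planValue, tiltedPlan, (integral_reroute hT _ hc.stronglyMeasurable
    (j1.mono_measure l1) ((integrable_sProd_const hγ.integrable_snd _).mono_measure l2)).2,
    integral_withDensity_ofReal (by fun_prop) (hθ.one_sub_nonneg hε hεM),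
    integral_withDensity_ofReal (by fun_prop) fun p => mul_nonneg hε.le (hθ.nonneg p)]
  congr 2
  · rw [← Measure.integral_condKernel]
    · refine integral_congr_ae ?_
      filter_upwards [hγ.ae_mean] with x hx
      obtain ⟨h1, h2⟩ := hθ.integral_condKernel_sub (ε := ε) hx 0
      rw [smul_zero, sub_zero] at h2
      rw [← h2, ← integral_sProd_const h1]
      simp only [sProd_smul_right, sub_zero, smul_eq_mul]
    · exact j1.bdd_smul 1 (Measurable.aestronglyMeasurable (by fun_prop)) (Eventually.of_forall
        (hθ.norm_one_sub_le hε hεM))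
  · rw [← integral_sProd_const hθ.integrable_smul_snd, ← integral_const_mul]
    simp only [sProd_smul_right, smul_eq_mul, mul_assoc]

/-- Exact expansion of the value of the moved mass in powers of `ε`. The remainder is quadratic. -/
lemma IsTilt.sProd_shiftedMean {m : ℕ} (hS : IsSymWithIndex d m S) (hθ : IsTilt γ θ M)
    (hε : 0 < ε) (hεM : ε * M ≤ 1 / 2) (x : E d) :
    sProd S (shiftedMean γ θ ε x) (x - ε • condMoment γ θ x)
      = sProd S x x - 2 * ε * sProd S x (condMoment γ θ x) + ε * (condMass γ θ x * sProd S x x)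
        + ε ^ 2 * ((1 - ε * condMass γ θ x)⁻¹ *
          sProd S (condMass γ θ x • x - condMoment γ θ x)
            (condMass γ θ x • x - condMoment γ θ x)) := by
  have h := hθ.half_le hε hεM x
  have hne : 1 - ε * condMass γ θ x ≠ 0 := by linarith
  rw [shiftedMean]
  simp only [sProd_sub_left, sProd_sub_right, sProd_smul_left, sProd_smul_right,
    hS.sProd_comm (condMoment γ θ x) x]
  generalize condMass γ θ x = a at *
  field_simp
  ring

/-- First-order condition: if `γ` is optimal, then gathering an infinitesimal mass, distributed
according to the density `θ`, at its mean does not increase the value. -/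
lemma IsOptimalPlan.sProd_mean_le {m : ℕ} (hS : IsSymWithIndex d m S)
    (hγ : IsOptimalPlan S ν γ) (hθ : IsTilt γ θ M) :
    sProd S (∫ p, θ p • p.2 ∂γ) (∫ p, θ p • p.2 ∂γ)
      ≤ ∫ p, θ p * (2 * sProd S p.1 p.2 - sProd S p.1 p.1) ∂γ := by
  obtain ⟨hγ, hopt⟩ := hγ
  obtain ⟨A, hA, hAle⟩ := exists_abs_sProd_le S
  have L0 := hγ.memLp_id_fst
  have Lb := hθ.memLp_condMoment
  have La : MemLp (fun x => condMass γ θ x • x) 2 γ.fst := by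
    refine L0.of_le_mul (c := M)
      (hθ.measurable_condMass.smul measurable_id).aestronglyMeasurable
      (Eventually.of_forall fun x => ?_)
    rw [norm_smul, Real.norm_of_nonneg (hθ.condMass_nonneg x)]
    exact mul_le_mul_of_nonneg_right (hθ.condMass_le x) (norm_nonneg _)
  have Lr : MemLp (fun x => condMass γ θ x • x - condMoment γ θ x) 2 γ.fst := La.sub Lb
  have ir := (memLp_two_iff_integrable_sq_norm Lr.1).mp Lr
  have i0 : Integrable (fun x => sProd S x x) γ.fst := integrable_sProd L0 L0
  have ib : Integrable (fun x => sProd S x (condMoment γ θ x)) γ.fst := integrable_sProd L0 Lb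
  have ia : Integrable (fun x => condMass γ θ x * sProd S x x) γ.fst := by
    simpa only [sProd_smul_left] using integrable_sProd (S := S) La L0
  have k1 : Integrable (fun p => θ p * sProd S p.1 p.2) γ := by
    simpa only [sProd_smul_right] using integrable_sProd (S := S) hγ.memLp_fst hθ.memLp_smul_snd
  have k2 : Integrable (fun p => θ p * sProd S p.1 p.1) γ :=
    (integrable_sProd hγ.memLp_fst hγ.memLp_fst).bdd_mul (c := M)
      hθ.measurable.aestronglyMeasurable (Eventually.of_forall hθ.abs_le)
  have eb : ∫ p, θ p * sProd S p.1 p.2 ∂γ = ∫ x, sProd S x (condMoment γ θ x) ∂γ.fst := by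
    rw [← Measure.integral_condKernel k1]
    refine integral_congr_ae (Eventually.of_forall fun x => ?_)
    have i2 : Integrable (fun y => θ (x, y) • y) (γ.condKernel x) :=
      Integrable.of_bound ((hθ.measurable.comp measurable_prodMk_left).smul
        measurable_id).aestronglyMeasurable M
        (Eventually.of_forall fun y => hθ.norm_smul_le (x, y))
    simp only [condMoment]
    rw [← integral_sProd_const i2]
    simp only [sProd_smul_right]
  have ea : ∫ p, θ p * sProd S p.1 p.1 ∂γ = ∫ x, condMass γ θ x * sProd S x x ∂γ.fst := by
    rw [← Measure.integral_condKernel k2]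
    refine integral_congr_ae (Eventually.of_forall fun x => ?_)
    simp only [condMass]
    rw [integral_mul_const]
  have e0 : ∫ p, sProd S p.1 p.2 ∂γ = ∫ x, sProd S x x ∂γ.fst := by
    rw [hγ.integral_sProd_fst_snd, integral_fst_eq (f := fun x => sProd S x x) i0.1]
  set c := ∫ p, θ p • p.2 ∂γ with hc
  set L := ∫ x, ‖condMass γ θ x • x - condMoment γ θ x‖ ^ 2 ∂γ.fst with hL
  have hM := hθ.pos
  have key : ∀ ε, 0 < ε → ε * M ≤ 1 / 2 → ε * (2 * A * L) * (-1) ≤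
      2 * ∫ p, θ p * sProd S p.1 p.2 ∂γ - ∫ p, θ p * sProd S p.1 p.1 ∂γ - sProd S c c := by
    intro ε hε hεM
    have hval := hopt _ (hθ.isPlan_tiltedPlan hγ hε hεM)
    rw [hθ.planValue_tiltedPlan hγ hε hεM, planValue, e0] at hval
    have hT2 := hθ.memLp_shiftedMean hγ hε hεM
    have iT : Integrable (fun x => sProd S (shiftedMean γ θ ε x) (x - ε • condMoment γ θ x))
        γ.fst := integrable_sProd hT2 (L0.sub (Lb.const_smul ε))
    have n1 : Integrable (fun x => sProd S x x - 2 * ε * sProd S x (condMoment γ θ x)) γ.fst :=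
      i0.sub (ib.const_mul _)
    have n2 : Integrable (fun x => sProd S x x - 2 * ε * sProd S x (condMoment γ θ x)
        + ε * (condMass γ θ x * sProd S x x)) γ.fst := n1.add (ia.const_mul _)
    have n3 : Integrable (fun x => ε ^ 2 * (2 * A) *
        ‖condMass γ θ x • x - condMoment γ θ x‖ ^ 2) γ.fst := ir.const_mul _
    have hlow : ∫ x, (sProd S x x - 2 * ε * sProd S x (condMoment γ θ x)
        + ε * (condMass γ θ x * sProd S x x)
        - ε ^ 2 * (2 * A) * ‖condMass γ θ x • x - condMoment γ θ x‖ ^ 2) ∂γ.fst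
        ≤ ∫ x, sProd S (shiftedMean γ θ ε x) (x - ε • condMoment γ θ x) ∂γ.fst := by
      refine integral_mono (n2.sub n3) iT fun x => ?_
      dsimp only
      rw [hθ.sProd_shiftedMean hS hε hεM]
      set r := condMass γ θ x • x - condMoment γ θ x
      have hD := hθ.half_le hε hεM x
      have hD0 : 0 < 1 - ε * condMass γ θ x := by linarith
      have hinv : (1 - ε * condMass γ θ x)⁻¹ ≤ 2 := by
        rw [inv_le_comm₀ hD0 two_pos]
        linarith
      have hq : -(A * ‖r‖ ^ 2) ≤ sProd S r r := by
        have := (_root_.abs_le.mp (hAle r r)).1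
        nlinarith
      have h1 : -(2 * (A * ‖r‖ ^ 2)) ≤ (1 - ε * condMass γ θ x)⁻¹ * sProd S r r := by
        have hp : 0 ≤ A * ‖r‖ ^ 2 := by positivity
        have h2 := mul_le_mul_of_nonneg_left hq (inv_nonneg.mpr hD0.le)
        have h3 := mul_le_mul_of_nonneg_right hinv hp
        linarith
      have h4 := mul_le_mul_of_nonneg_left h1 (sq_nonneg ε)
      linarith
    rw [integral_sub n2 n3, integral_add n1 (ia.const_mul _), integral_sub i0 (ib.const_mul _),
      integral_const_mul, integral_const_mul, integral_const_mul, ← eb, ← ea, ← hL] at hlow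
    refine le_of_mul_le_mul_left ?_ hε
    linarith
  have hfin : 0 ≤ 2 * ∫ p, θ p * sProd S p.1 p.2 ∂γ - ∫ p, θ p * sProd S p.1 p.1 ∂γ
      - sProd S c c := by
    refine nonneg_of_forall_mul_le (b := -((2 * M)⁻¹ * (2 * A * L))) fun t ht0 ht1 => ?_
    have h := key (t * (2 * M)⁻¹) (by positivity) (by
      rw [mul_inv, mul_assoc, mul_assoc, inv_mul_cancel₀ hM.ne']
      linarith)
    linarith
  have e : ∫ p, θ p * (2 * sProd S p.1 p.2 - sProd S p.1 p.1) ∂γ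
      = 2 * ∫ p, θ p * sProd S p.1 p.2 ∂γ - ∫ p, θ p * sProd S p.1 p.1 ∂γ := by
    rw [← integral_const_mul, ← integral_sub (k1.const_mul 2) k2]
    refine integral_congr_ae (Eventually.of_forall fun p => ?_)
    ring
  rw [e]
  linarith

end Finite

end Perturbation

section DualSet

variable {ν : Measure (E d)} {γ : Measure ((E d) × (E d))}

/-! ### The convex set attached to an optimal plan -/

/-- The point of `ℝᵈ × ℝ` above `y` whose height `S(x, y) - ½ S(x, x)` is the marginal value of
adding mass at `y` to the mass that is gathered at `x`. -/
noncomputable def liftPoint (S : Matrix (Fin d) (Fin d) ℝ) (p : (E d) × (E d)) : (E d) × ℝ :=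
  (p.2, sProd S p.1 p.2 - 1 / 2 * sProd S p.1 p.1)

/-- The averages of `liftPoint S` with respect to bounded densities. -/
def tiltedMeans (S : Matrix (Fin d) (Fin d) ℝ) (γ : Measure ((E d) × (E d))) : Set ((E d) × ℝ) :=
  {e | ∃ θ M, IsTilt γ θ M ∧ ∫ p, θ p • liftPoint S p ∂γ = e}

lemma continuous_liftPoint : Continuous (liftPoint S) := by
  unfold liftPoint
  fun_prop

lemma IsPlan.integrable_liftPoint (hγ : IsPlan ν γ) : Integrable (liftPoint S) γ :=
  hγ.integrable_snd.prodMk ((integrable_sProd hγ.memLp_fst hγ.memLp_snd).sub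
    ((integrable_sProd hγ.memLp_fst hγ.memLp_fst).const_mul _))

lemma IsPlan.integral_liftPoint_snd (hγ : IsPlan ν γ) :
    ∫ p, (liftPoint S p).2 ∂γ = planValue S γ := by
  simp only [liftPoint, planValue]
  rw [integral_sub (integrable_sProd hγ.memLp_fst hγ.memLp_snd)
    ((integrable_sProd hγ.memLp_fst hγ.memLp_fst).const_mul _), integral_const_mul,
    ← hγ.integral_sProd_fst_snd]
  ring

lemma IsTilt.integrable_smul_liftPoint {θ : (E d) × (E d) → ℝ} {M : ℝ} (hγ : IsPlan ν γ)
    (hθ : IsTilt γ θ M) : Integrable (fun p => θ p • liftPoint S p) γ :=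
  hγ.integrable_liftPoint.bdd_smul M hθ.measurable.aestronglyMeasurable
    (Eventually.of_forall hθ.abs_le)

lemma IsPlan.convex_tiltedMeans (hγ : IsPlan ν γ) : Convex ℝ (tiltedMeans S γ) := by
  have := hγ.isProbabilityMeasure
  rintro _ ⟨θ₁, M₁, h₁, rfl⟩ _ ⟨θ₂, M₂, h₂, rfl⟩ a b ha hb hab
  have key : ∀ {u v : ℝ}, u ≤ M₁ → v ≤ M₂ → a * u + b * v ≤ M₁ + M₂ := by
    intro u v hu hv
    have p1 := h₁.pos
    have p2 := h₂.pos
    nlinarith [mul_le_mul_of_nonneg_left hu ha, mul_le_mul_of_nonneg_left hv hb]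
  refine ⟨fun p => a * θ₁ p + b * θ₂ p, M₁ + M₂, ⟨add_pos h₁.pos h₂.pos, ?_, fun p => ?_,
    fun p => key (h₁.le p) (h₂.le p), fun p => ?_, ?_⟩, ?_⟩
  · exact (h₁.measurable.const_mul a).add (h₂.measurable.const_mul b)
  · exact add_nonneg (mul_nonneg ha (h₁.nonneg p)) (mul_nonneg hb (h₂.nonneg p))
  · have e : (a * θ₁ p + b * θ₂ p) • p.2 = a • (θ₁ p • p.2) + b • (θ₂ p • p.2) := by module
    rw [e]
    refine (norm_add_le _ _).trans ?_
    rw [norm_smul a, norm_smul b, Real.norm_of_nonneg ha, Real.norm_of_nonneg hb]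
    exact key (h₁.norm_smul_le p) (h₂.norm_smul_le p)
  · rw [integral_add (h₁.integrable.const_mul a) (h₂.integrable.const_mul b), integral_const_mul,
      integral_const_mul, h₁.integral_eq_one, h₂.integral_eq_one]
    linarith
  · have e : ∀ p, (a * θ₁ p + b * θ₂ p) • liftPoint S p
        = a • (θ₁ p • liftPoint S p) + b • (θ₂ p • liftPoint S p) := fun p => by module
    simp only [e]
    rw [integral_add, integral_smul, integral_smul]
    · exact (h₁.integrable_smul_liftPoint hγ).smul a
    · exact (h₂.integrable_smul_liftPoint hγ).smul b

lemma IsOptimalPlan.tiltedMeans_subset {m : ℕ} (hS : IsSymWithIndex d m S)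
    (hγ : IsOptimalPlan S ν γ) : tiltedMeans S γ ⊆ quadEpigraph S := by
  have := hγ.1.isProbabilityMeasure
  rintro _ ⟨θ, M, hθ, rfl⟩
  have h := hγ.sProd_mean_le hS hθ
  have i := hθ.integrable_smul_liftPoint (S := S) hγ.1
  rw [mem_quadEpigraph, fst_integral i, snd_integral i]
  have e : ∫ p, θ p * (2 * sProd S p.1 p.2 - sProd S p.1 p.1) ∂γ
      = 2 * ∫ p, (θ p • liftPoint S p).2 ∂γ := by
    rw [← integral_const_mul]
    refine integral_congr_ae (Eventually.of_forall fun p => ?_)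
    simp only [liftPoint, Prod.smul_mk, smul_eq_mul]
    ring
  rw [e] at h
  simp only [Prod.smul_fst, liftPoint] at h ⊢
  linarith

lemma IsPlan.liftPoint_mem_closure (hγ : IsPlan ν γ) {p : (E d) × (E d)} (hp : p ∈ γ.support) :
    liftPoint S p ∈ closure (tiltedMeans S γ) := by
  have := hγ.isProbabilityMeasure
  refine Metric.mem_closure_iff.mpr fun η hη => ?_
  obtain ⟨δ, hδ, hball⟩ := Metric.continuousAt_iff.mp
    ((continuous_liftPoint (S := S)).continuousAt (x := p)) (η / 2) (by positivity)
  set B := Metric.ball p δ with hB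
  have hB0 : γ B ≠ 0 :=
    (Measure.mem_support_iff_forall p |>.mp hp B (Metric.ball_mem_nhds p hδ)).ne'
  have hBm : MeasurableSet B := Metric.isOpen_ball.measurableSet
  have hBr : 0 < γ.real B := ENNReal.toReal_pos hB0 (measure_ne_top _ _)
  have hi : 0 < (γ.real B)⁻¹ := inv_pos.mpr hBr
  -- the normalized indicator of a small ball around `p`
  have e : ∀ {F : Type} [NormedAddCommGroup F] [NormedSpace ℝ F] (f : (E d) × (E d) → F),
      ∫ q, B.indicator (fun _ => (γ.real B)⁻¹) q • f q ∂γ = ⨍ q in B, f q ∂γ := by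
    intro F _ _ f
    rw [setAverage_eq, ← integral_smul, ← integral_indicator hBm]
    refine integral_congr_ae (Eventually.of_forall fun q => ?_)
    by_cases hq : q ∈ B <;> simp [hq]
  have hθ : IsTilt γ (B.indicator fun _ => (γ.real B)⁻¹) ((γ.real B)⁻¹ * (1 + ‖p‖ + δ)) := by
    have hM : (γ.real B)⁻¹ ≤ (γ.real B)⁻¹ * (1 + ‖p‖ + δ) :=
      le_mul_of_one_le_right hi.le (by linarith [norm_nonneg p])
    refine ⟨by positivity, measurable_const.indicator hBm,
      fun q => Set.indicator_nonneg (fun _ _ => hi.le) q, fun q => ?_, fun q => ?_, ?_⟩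
    · exact (Set.indicator_le_self' (fun _ _ => hi.le) q).trans hM
    · by_cases hq : q ∈ B
      · rw [Set.indicator_of_mem hq, norm_smul, Real.norm_of_nonneg hi.le]
        refine mul_le_mul_of_nonneg_left ?_ hi.le
        have h1 : ‖q.2‖ ≤ ‖q‖ := norm_snd_le q
        have h2 : ‖q - p‖ < δ := by rwa [← dist_eq_norm]
        have h3 : ‖q‖ ≤ ‖p‖ + ‖q - p‖ := by
          calc ‖q‖ = ‖p + (q - p)‖ := by congr 1; abel
            _ ≤ _ := norm_add_le _ _
        linarith
      · rw [Set.indicator_of_notMem hq, zero_smul, norm_zero]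
        positivity
    · rw [integral_indicator hBm, setIntegral_const, smul_eq_mul, mul_inv_cancel₀ hBr.ne']
  refine ⟨_, ⟨_, _, hθ, rfl⟩, ?_⟩
  rw [e, dist_comm]
  have hmem : (⨍ q in B, liftPoint S q ∂γ) ∈ Metric.closedBall (liftPoint S p) (η / 2) := by
    refine (convex_closedBall _ _).set_average_mem Metric.isClosed_closedBall hB0
      (measure_ne_top _ _) ?_ hγ.integrable_liftPoint.integrableOn
    filter_upwards [ae_restrict_mem hBm] with q hq using (hball hq).le
  exact lt_of_le_of_lt (Metric.mem_closedBall.mp hmem) (by linarith)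

/-- An optimal plan is carried by a maximal convex set above the graph of `½ S(y, y)`. -/
lemma IsOptimalPlan.exists_isMaxConvex {m : ℕ} (hS : IsSymWithIndex d m S)
    (hγ : IsOptimalPlan S ν γ) :
    ∃ C, IsMaxConvex S C ∧ C.Nonempty ∧ ∀ p ∈ γ.support, liftPoint S p ∈ C := by
  have := hγ.1.isProbabilityMeasure
  obtain ⟨C, hsub, hC⟩ := exists_isMaxConvex_superset hγ.1.convex_tiltedMeans
    (hγ.tiltedMeans_subset hS)
  have h : ∀ p ∈ γ.support, liftPoint S p ∈ C := fun p hp =>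
    closure_minimal hsub hC.isClosed (hγ.1.liftPoint_mem_closure hp)
  obtain ⟨p, hp⟩ := Measure.nonempty_support (IsProbabilityMeasure.ne_zero γ)
  exact ⟨C, hC, ⟨_, h p hp⟩, h⟩

end DualSet

/-! ### Integrals of extended real functions -/

section ERealIntegral

variable {Ω : Type*} [MeasurableSpace Ω] {μ : Measure Ω}

lemma erealIntegral_mono {f g : Ω → EReal} (h : ∀ᵐ ω ∂μ, f ω ≤ g ω) :
    erealIntegral f μ ≤ erealIntegral g μ := by
  refine EReal.sub_le_sub ?_ ?_
  · refine EReal.coe_ennreal_le_coe_ennreal_iff.mpr (lintegral_mono_ae ?_)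
    filter_upwards [h] with ω hω using EReal.toENNReal_le_toENNReal hω
  · refine EReal.coe_ennreal_le_coe_ennreal_iff.mpr (lintegral_mono_ae ?_)
    filter_upwards [h] with ω hω using EReal.toENNReal_le_toENNReal (EReal.neg_le_neg_iff.mpr hω)

lemma erealIntegral_congr {f g : Ω → EReal} (h : ∀ᵐ ω ∂μ, f ω = g ω) :
    erealIntegral f μ = erealIntegral g μ :=
  le_antisymm (erealIntegral_mono (h.mono fun _ => le_of_eq))
    (erealIntegral_mono (h.mono fun _ => ge_of_eq))

lemma erealIntegral_coe {f : Ω → ℝ} (hf : Integrable f μ) :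
    erealIntegral (fun ω => (f ω : EReal)) μ = ((∫ ω, f ω ∂μ : ℝ) : EReal) := by
  have h1 : ∫⁻ ω, ENNReal.ofReal (f ω) ∂μ ≠ ∞ := hf.lintegral_lt_top.ne
  have h2 : ∫⁻ ω, ENNReal.ofReal (-f ω) ∂μ ≠ ∞ := hf.neg.lintegral_lt_top.ne
  rw [integral_eq_lintegral_pos_part_sub_lintegral_neg_part hf, EReal.coe_sub,
    EReal.coe_ennreal_toReal h1, EReal.coe_ennreal_toReal h2]
  rfl

lemma erealIntegral_map {Ω' : Type*} [MeasurableSpace Ω'] {f : Ω' → EReal} (hf : Measurable f)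
    {g : Ω → Ω'} (hg : Measurable g) :
    erealIntegral f (μ.map g) = erealIntegral (fun ω => f (g ω)) μ := by
  unfold erealIntegral
  rw [lintegral_map (by fun_prop) hg, lintegral_map (by fun_prop) hg]

/-- A function with an integrable minorant and an integral less than `+∞` is integrable. -/
lemma integrable_of_erealIntegral_le {f : Ω → EReal} (hf : Measurable f) {g : Ω → ℝ}
    (hg : Integrable g μ) (hgf : ∀ ω, (g ω : EReal) ≤ f ω) {c : ℝ}
    (hc : erealIntegral f μ ≤ c) :
    (∀ᵐ ω ∂μ, f ω = ((f ω).toReal : EReal)) ∧ Integrable (fun ω => (f ω).toReal) μ ∧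
      ∫ ω, (f ω).toReal ∂μ ≤ c := by
  have hneg : ∫⁻ ω, (-f ω).toENNReal ∂μ ≠ ∞ := by
    refine (lt_of_le_of_lt (lintegral_mono fun ω => ?_) hg.neg.lintegral_lt_top).ne
    have := EReal.toENNReal_le_toENNReal (EReal.neg_le_neg_iff.mpr (hgf ω))
    exact this
  have hpos : ∫⁻ ω, (f ω).toENNReal ∂μ ≠ ∞ := by
    intro h
    rw [erealIntegral, h] at hc
    lift ∫⁻ ω, (-f ω).toENNReal ∂μ to NNReal using hneg with r
    have e : ((⊤ : ℝ≥0∞) : EReal) - ((r : ℝ≥0∞) : EReal) = ⊤ := EReal.top_sub_coe r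
    rw [e] at hc
    exact absurd hc (not_le.mpr (EReal.coe_lt_top c))
  have hfin : ∀ᵐ ω ∂μ, f ω = ((f ω).toReal : EReal) := by
    filter_upwards [ae_lt_top (by fun_prop) hpos] with ω hω
    refine (EReal.coe_toReal (EReal.toENNReal_ne_top_iff.mp hω.ne) ?_).symm
    intro h
    have := hgf ω
    rw [h] at this
    exact absurd this (not_le.mpr (EReal.bot_lt_coe _))
  have hint : Integrable (fun ω => (f ω).toReal) μ := by
    refine ⟨hf.ereal_toReal.aestronglyMeasurable, ?_⟩
    have h1 : ∫⁻ ω, ‖(f ω).toReal‖ₑ ∂μ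
        ≤ ∫⁻ ω, ((f ω).toENNReal + (-f ω).toENNReal) ∂μ := by
      refine lintegral_mono_ae ?_
      filter_upwards [hfin] with ω hω
      generalize (f ω).toReal = r at *
      rw [hω, ← EReal.coe_neg, EReal.real_coe_toENNReal, EReal.real_coe_toENNReal,
        Real.enorm_eq_ofReal_abs]
      rcases le_total 0 r with h | h
      · rw [abs_of_nonneg h]
        exact le_self_add
      · rw [abs_of_nonpos h]
        exact le_add_self
    refine lt_of_le_of_lt h1 ?_
    rw [lintegral_add_left (by fun_prop)]
    exact ENNReal.add_lt_top.mpr ⟨hpos.lt_top, hneg.lt_top⟩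
  refine ⟨hfin, hint, ?_⟩
  rw [erealIntegral_congr hfin, erealIntegral_coe hint] at hc
  exact EReal.coe_le_coe_iff.mp hc

end ERealIntegral

/-! ### Fitzpatrick functions and projections -/

section Fitzpatrick

variable {G : Set (E d)}

lemma measurable_fitzpatrick : Measurable (fitzpatrick S G) := by
  refine LowerSemicontinuous.measurable (lowerSemicontinuous_biSup fun x _ => ?_)
  refine Continuous.lowerSemicontinuous (continuous_coe_real_ereal.comp ?_)
  fun_prop

lemma le_fitzpatrick {z : E d} (hz : z ∈ G) (y : E d) :
    ((sProd S z y - 1 / 2 * sProd S z z : ℝ) : EReal) ≤ fitzpatrick S G y :=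
  le_iSup₂_of_le z hz le_rfl

lemma MaximalSMonotone.mem_of_forall (hG : MaximalSMonotone S G) {x : E d}
    (hx : ∀ z ∈ G, 0 ≤ sProd S (x - z) (x - z)) :
    x ∈ G := by
  by_contra hxG
  refine hG.2 (insert x G) ?_ (Set.ssubset_insert hxG)
  rintro a (rfl | ha) b (rfl | hb)
  · simp [sProd]
  · exact hx b hb
  · have h := hx a ha
    simp only [sProd_sub_left, sProd_sub_right] at h ⊢
    linarith
  · exact hG.1 a ha b hb

lemma MaximalSMonotone.nonempty (hG : MaximalSMonotone S G) : G.Nonempty := by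
  by_contra! h
  have : (0 : E d) ∈ G := hG.mem_of_forall (by simp [h])
  simp [h] at this

lemma MaximalSMonotone.isClosed (hG : MaximalSMonotone S G) : IsClosed G := by
  refine isClosed_of_closure_subset fun x hx => hG.mem_of_forall fun z hz => ?_
  have hc : IsClosed {x : E d | 0 ≤ sProd S (x - z) (x - z)} :=
    isClosed_le continuous_const (by fun_prop)
  exact closure_minimal (fun w hw => hG.1 w hw z hz) hc hx

/-- The Fitzpatrick function dominates `½ S(x, x)`. -/
lemma MaximalSMonotone.exists_half_le {m : ℕ} (hS : IsSymWithIndex d m S)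
    (hG : MaximalSMonotone S G) (x : E d) :
    ∃ z ∈ G, 1 / 2 * sProd S x x ≤ sProd S z x - 1 / 2 * sProd S z z := by
  by_contra! h
  have hx : x ∈ G := hG.mem_of_forall fun z hz => by
    have := h z hz
    simp only [sProd_sub_left, sProd_sub_right, hS.sProd_comm x z]
    linarith
  have := h x hx
  linarith

lemma mem_sProj_iff {m : ℕ} (hS : IsSymWithIndex d m S) {x y : E d} :
    x ∈ sProj S G y ↔ x ∈ G ∧ ∀ z ∈ G,
      sProd S z y - 1 / 2 * sProd S z z ≤ sProd S x y - 1 / 2 * sProd S x x := by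
  refine and_congr_right fun _ => forall₂_congr fun z _ => ?_
  simp only [sProd_sub_left, sProd_sub_right, hS.sProd_comm y]
  constructor <;> intro h <;> linarith

lemma fitzpatrick_eq_of_mem_sProj {m : ℕ} (hS : IsSymWithIndex d m S) {x y : E d}
    (h : x ∈ sProj S G y) :
    fitzpatrick S G y = ((sProd S x y - 1 / 2 * sProd S x x : ℝ) : EReal) := by
  rw [mem_sProj_iff hS] at h
  exact le_antisymm (iSup₂_le fun z hz => EReal.coe_le_coe_iff.mpr (h.2 z hz))
    (le_fitzpatrick h.1 y)

lemma SMonotone.mem_sProj_self_iff {x z : E d} (hG : SMonotone S G) (hx : x ∈ G) :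
    z ∈ sProj S G x ↔ z ∈ G ∧ sProd S (z - x) (z - x) = 0 := by
  have h0 : sProd S (x - x) (x - x) = 0 := by simp [sProd]
  constructor
  · rintro ⟨hz, h⟩
    exact ⟨hz, le_antisymm ((h x hx).trans h0.le) (hG z hz x hx)⟩
  · rintro ⟨hz, h⟩
    exact ⟨hz, fun w hw => h.le.trans (hG w hw x hx)⟩

lemma mem_sProj_self {x : E d} (hG : SMonotone S G) (hx : x ∈ G) : x ∈ sProj S G x :=
  (hG.mem_sProj_self_iff hx).mpr ⟨hx, by simp [sProd]⟩

lemma isClosed_setOf_mem_sProj (hG : IsClosed G) :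
    IsClosed {p : (E d) × (E d) | p.1 ∈ sProj S G p.2} := by
  have e : {p : (E d) × (E d) | p.1 ∈ sProj S G p.2} = Prod.fst ⁻¹' G ∩
      ⋂ z ∈ G, {p | sProd S (p.1 - p.2) (p.1 - p.2) ≤ sProd S (z - p.2) (z - p.2)} := by
    ext p
    simp [sProj]
  rw [e]
  exact (hG.preimage continuous_fst).inter (isClosed_biInter fun z _ =>
    isClosed_le (by fun_prop) (by fun_prop))

/-- The points `(x, y)` with `P_G(x) ⊆ P_G(y)` form a Borel set: the complement is a projection of
the intersection of a closed and an open set, hence of a `σ`-compact set. -/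
lemma measurableSet_sProj_subset (hG : IsClosed G) :
    MeasurableSet {p : (E d) × (E d) | sProj S G p.1 ⊆ sProj S G p.2} := by
  have hR := isClosed_setOf_mem_sProj (S := S) hG
  set Q : Set (((E d) × (E d)) × (E d)) := {q | q.2 ∈ sProj S G q.1.1} with hQ
  set U : Set (((E d) × (E d)) × (E d)) := {q | q.2 ∉ sProj S G q.1.2} with hU
  have hQc : IsClosed Q := hR.preimage (f := fun q : ((E d) × (E d)) × (E d) => (q.2, q.1.1))
    (by fun_prop)
  have hUo : IsOpen U := (hR.preimage
    (f := fun q : ((E d) × (E d)) × (E d) => (q.2, q.1.2)) (by fun_prop)).isOpen_compl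
  obtain ⟨F, hF, -, hFU, -⟩ := hUo.exists_iUnion_isClosed
  have e : {p : (E d) × (E d) | sProj S G p.1 ⊆ sProj S G p.2}ᶜ
      = ⋃ n, Prod.fst '' (Q ∩ F n) := by
    rw [← Set.image_iUnion, ← Set.inter_iUnion, hFU]
    ext p
    simp [hQ, hU, Set.not_subset]
  refine MeasurableSet.of_compl ?_
  rw [e]
  refine MeasurableSet.iUnion fun n => ?_
  obtain ⟨K, hK, hKu⟩ := (isSigmaCompact_univ.of_isClosed_subset (hQc.inter (hF n))
    (Set.subset_univ _)).image continuous_fst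
  rw [← hKu]
  exact MeasurableSet.iUnion fun k => (hK k).measurableSet

lemma fitzpatrick_contactSet_le {m : ℕ} (hS : IsSymWithIndex d m S) {C : Set ((E d) × ℝ)}
    (hC : IsMaxConvex S C) {p : (E d) × ℝ} (hp : p ∈ C) :
    fitzpatrick S (contactSet S C) p.1 ≤ (p.2 : EReal) :=
  iSup₂_le fun _ hz =>
    EReal.coe_le_coe_iff.mpr (le_of_mem_contactSet hS hC.convex hC.subset hz hp)

end Fitzpatrick

/-! ### Duality -/

section Duality

variable {ν : Measure (E d)} {γ : Measure ((E d) × (E d))} {G : Set (E d)} {m : ℕ}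

lemma IsPlan.erealIntegral_fitzpatrick (hγ : IsPlan ν γ) :
    erealIntegral (fitzpatrick S G) ν = erealIntegral (fun p => fitzpatrick S G p.2) γ := by
  rw [← hγ.map_snd]
  exact erealIntegral_map measurable_fitzpatrick measurable_snd

/-- If the integral of the Fitzpatrick function `ψ` is at most `c`, then its conditional mean
`φ(x)` given `x` is integrable, with integral at most `c`, and dominates the affine minorants of
`ψ` at `x`. This is Jensen's inequality for a supremum of affine functions. -/
lemma IsPlan.exists_condMean [IsProbabilityMeasure γ]
    (hγ : IsPlan ν γ) (hG : G.Nonempty) {c : ℝ} (hc : erealIntegral (fitzpatrick S G) ν ≤ c) :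
    (∀ᵐ p ∂γ, fitzpatrick S G p.2 = ((fitzpatrick S G p.2).toReal : EReal)) ∧
    Integrable (fun p => (fitzpatrick S G p.2).toReal) γ ∧
    ∫ p, (fitzpatrick S G p.2).toReal ∂γ ≤ c ∧
    ∀ᵐ x ∂γ.fst, ∀ z ∈ G, sProd S z x - 1 / 2 * sProd S z z
      ≤ ∫ y, (fitzpatrick S G y).toReal ∂γ.condKernel x := by
  obtain ⟨z₀, hz₀⟩ := hG
  rw [hγ.erealIntegral_fitzpatrick] at hc
  have hm : Measurable fun p : (E d) × (E d) => fitzpatrick S G p.2 :=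
    measurable_fitzpatrick.comp measurable_snd
  have hi : Integrable (fun p => sProd S z₀ p.2 - 1 / 2 * sProd S z₀ z₀) γ :=
    (integrable_sProd_const hγ.integrable_snd z₀).sub (integrable_const _)
  obtain ⟨h1, h2, h3⟩ :=
    integrable_of_erealIntegral_le hm hi (fun p => le_fitzpatrick hz₀ p.2) hc
  refine ⟨h1, h2, h3, ?_⟩
  have h1' := h1
  rw [← γ.disintegrate γ.condKernel] at h1'
  filter_upwards [hγ.ae_mean, h2.condKernel_ae, Measure.ae_ae_of_ae_compProd h1']
    with x hx hx2 hx1 z hz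
  have e : sProd S z x - 1 / 2 * sProd S z z
      = ∫ y, (sProd S z y - 1 / 2 * sProd S z z) ∂γ.condKernel x := by
    rw [integral_sub (integrable_sProd_const hx.1 z) (integrable_const _),
      integral_sProd_const hx.1, hx.2]
    simp
  rw [e]
  refine integral_mono_ae ((integrable_sProd_const hx.1 z).sub (integrable_const _)) hx2 ?_
  filter_upwards [hx1] with y hy
  have h := le_fitzpatrick (S := S) hz y
  rw [hy] at h
  exact EReal.coe_le_coe_iff.mp h

lemma IsPlan.integrable_half (hγ : IsPlan ν γ) :
    Integrable (fun x => 1 / 2 * sProd S x x) γ.fst :=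
  (integrable_sProd hγ.memLp_id_fst hγ.memLp_id_fst).const_mul _

lemma IsPlan.integral_half (hγ : IsPlan ν γ) :
    ∫ x, 1 / 2 * sProd S x x ∂γ.fst = planValue S γ := by
  have h : AEStronglyMeasurable (fun x => sProd S x x) γ.fst :=
    (integrable_sProd hγ.memLp_id_fst hγ.memLp_id_fst).1
  rw [integral_const_mul, integral_fst_eq h, ← hγ.integral_sProd_fst_snd, planValue]

/-- Weak duality. -/
lemma IsPlan.planValue_le (hS : IsSymWithIndex d m S) (hγ : IsPlan ν γ)
    (hG : MaximalSMonotone S G) :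
    (planValue S γ : EReal) ≤ erealIntegral (fitzpatrick S G) ν := by
  have := hγ.isProbabilityMeasure
  by_contra! hlt
  obtain ⟨c, hc1, hc2⟩ := EReal.lt_iff_exists_real_btwn.mp hlt
  obtain ⟨-, h2, h3, h4⟩ := hγ.exists_condMean (hG.nonempty) hc1.le
  rw [← Measure.integral_condKernel h2] at h3
  have h5 : planValue S γ ≤ c := by
    rw [← hγ.integral_half]
    refine (integral_mono_ae hγ.integrable_half h2.integral_condKernel ?_).trans h3
    filter_upwards [h4] with x hx
    obtain ⟨z, hz, hzx⟩ := hG.exists_half_le hS x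
    exact hzx.trans (hx z hz)
  exact absurd (EReal.coe_lt_coe_iff.mp hc2) (not_lt.mpr h5)

/-- The equality case of weak duality. -/
lemma IsPlan.ae_mem_sProj (hS : IsSymWithIndex d m S) (hγ : IsPlan ν γ)
    (hG : MaximalSMonotone S G) (hle : erealIntegral (fitzpatrick S G) ν ≤ planValue S γ) :
    ∀ᵐ p ∂γ, p.1 ∈ sProj S G p.2 := by
  have := hγ.isProbabilityMeasure
  obtain ⟨h1, h2, h3, h4⟩ := hγ.exists_condMean (hG.nonempty) hle
  have hge : (fun x => 1 / 2 * sProd S x x)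
      ≤ᵐ[γ.fst] fun x => ∫ y, (fitzpatrick S G y).toReal ∂γ.condKernel x := by
    filter_upwards [h4] with x hx
    obtain ⟨z, hz, hzx⟩ := hG.exists_half_le hS x
    exact hzx.trans (hx z hz)
  have h3' := h3
  rw [← Measure.integral_condKernel h2] at h3'
  have heq := (integral_eq_iff_of_ae_le hγ.integrable_half h2.integral_condKernel hge).mp
    (le_antisymm (integral_mono_ae hγ.integrable_half h2.integral_condKernel hge)
      (h3'.trans hγ.integral_half.ge))
  have hmem : ∀ᵐ x ∂γ.fst, x ∈ G := by
    filter_upwards [h4, heq] with x hx hxe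
    refine hG.mem_of_forall fun z hz => ?_
    have := hx z hz
    rw [← hxe] at this
    simp only [sProd_sub_left, sProd_sub_right, hS.sProd_comm x z]
    linarith
  have hmem' := ae_of_ae_fst hmem
  have hi := hγ.integrable_liftPoint (S := S)
  have hge2 : (fun p => (liftPoint S p).2) ≤ᵐ[γ] fun p => (fitzpatrick S G p.2).toReal := by
    filter_upwards [h1, hmem'] with p hp hpG
    have h := le_fitzpatrick (S := S) hpG p.2
    rw [hp] at h
    exact EReal.coe_le_coe_iff.mp h
  have heq2 := (integral_eq_iff_of_ae_le hi.snd h2 hge2).mp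
    (le_antisymm (integral_mono_ae hi.snd h2 hge2) (h3.trans hγ.integral_liftPoint_snd.ge))
  filter_upwards [h1, hmem', heq2] with p hp hpG hpe
  refine (mem_sProj_iff hS).mpr ⟨hpG, fun z hz => ?_⟩
  have h := le_fitzpatrick (S := S) hz p.2
  rw [hp, ← hpe] at h
  exact EReal.coe_le_coe_iff.mp h

lemma IsPlan.erealIntegral_eq (hS : IsSymWithIndex d m S) (hγ : IsPlan ν γ)
    (h : ∀ᵐ p ∂γ, p.1 ∈ sProj S G p.2) :
    erealIntegral (fitzpatrick S G) ν = planValue S γ := by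
  rw [hγ.erealIntegral_fitzpatrick, ← hγ.integral_liftPoint_snd,
    ← erealIntegral_coe (hγ.integrable_liftPoint (S := S)).snd]
  refine erealIntegral_congr ?_
  filter_upwards [h] with p hp using fitzpatrick_eq_of_mem_sProj hS hp

/-- Absence of a duality gap: the contact set of the maximal convex set attached to an optimal plan
attains the value of the plan. -/
lemma IsOptimalPlan.exists_maximalSMonotone (hS : IsSymWithIndex d m S)
    (hγ : IsOptimalPlan S ν γ) :
    ∃ H, MaximalSMonotone S H ∧ erealIntegral (fitzpatrick S H) ν ≤ planValue S γ := by
  obtain ⟨C, hC, hne, hsupp⟩ := hγ.exists_isMaxConvex hS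
  refine ⟨contactSet S C, hC.maximalSMonotone_contactSet hS hne, ?_⟩
  rw [hγ.1.erealIntegral_fitzpatrick, ← hγ.1.integral_liftPoint_snd,
    ← erealIntegral_coe (hγ.1.integrable_liftPoint (S := S)).snd]
  refine erealIntegral_mono ?_
  filter_upwards [Measure.support_mem_ae (μ := γ)] with p hp
  have h := fitzpatrick_contactSet_le hS hC (hsupp p hp)
  simpa only [liftPoint] using h

/-- If `x` is almost surely a projection of `y`, then almost surely all points of `P_G(x)` are
projections of `y`. Indeed, `S(z - x, y - x) ≤ 0` for `z` in `P_G(x)`, while the conditional mean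
of this quantity given `x` is zero. -/
lemma IsPlan.ae_sProj_subset (hS : IsSymWithIndex d m S) (hγ : IsPlan ν γ)
    (hG : MaximalSMonotone S G) (h : ∀ᵐ p ∂γ, p.1 ∈ sProj S G p.2) :
    ∀ᵐ p ∂γ, sProj S G p.1 ⊆ sProj S G p.2 := by
  have := hγ.isProbabilityMeasure
  rw [← γ.disintegrate γ.condKernel] at h ⊢
  refine Measure.ae_compProd_of_ae_ae (measurableSet_sProj_subset (hG.isClosed)) ?_
  filter_upwards [hγ.ae_mean, Measure.ae_ae_of_ae_compProd h] with x hx hxP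
  have hxG : x ∈ G := by
    obtain ⟨y, hy⟩ := hxP.exists
    exact hy.1
  obtain ⟨D, hDP, hD, hPD⟩ :=
    (TopologicalSpace.IsSeparable.of_separableSpace (sProj S G x)).exists_countable_dense_subset
  have hi : ∀ z, Integrable (fun y => sProd S (z - x) (y - x)) (γ.condKernel x) := fun z =>
    integrable_sProd_const (hx.1.sub (integrable_const x)) _
  have hzero : ∀ z, ∫ y, sProd S (z - x) (y - x) ∂γ.condKernel x = 0 := by
    intro z
    rw [integral_sProd_const (f := fun y => y - x) (hx.1.sub (integrable_const x)),
      integral_sub hx.1 (integrable_const x), hx.2]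
    simp [sProd]
  have hneg : ∀ y, x ∈ sProj S G y → ∀ z ∈ sProj S G x, sProd S (z - x) (y - x) ≤ 0 := by
    intro y hy z hz
    obtain ⟨hzG, hz0⟩ := (hG.1.mem_sProj_self_iff hxG).mp hz
    have h1 := ((mem_sProj_iff hS).mp hy).2 z hzG
    simp only [sProd_sub_left, sProd_sub_right, hS.sProd_comm x z] at hz0 ⊢
    linarith
  have hae : ∀ᵐ y ∂γ.condKernel x, ∀ z ∈ D, sProd S (z - x) (y - x) = 0 := by
    rw [ae_ball_iff hD]
    intro z hz
    have hle : (fun y => sProd S (z - x) (y - x)) ≤ᵐ[γ.condKernel x] fun _ => (0 : ℝ) := by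
      filter_upwards [hxP] with y hy using hneg y hy z (hDP hz)
    exact (integral_eq_iff_of_ae_le (hi z) (integrable_const _) hle).mp (by simp [hzero])
  filter_upwards [hxP, hae] with y hy hyD z hz
  have hcl : IsClosed {z : E d | sProd S (z - x) (y - x) = 0} :=
    isClosed_eq (by fun_prop) continuous_const
  have hz1 : sProd S (z - x) (y - x) = 0 := closure_minimal hyD hcl (hPD hz)
  obtain ⟨hzG, hz0⟩ := (hG.1.mem_sProj_self_iff hxG).mp hz
  refine (mem_sProj_iff hS).mpr ⟨hzG, fun w hw => ?_⟩
  refine (((mem_sProj_iff hS).mp hy).2 w hw).trans ?_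
  simp only [sProd_sub_left, sProd_sub_right, hS.sProd_comm x z] at hz0 hz1
  linarith

end Duality

end BackwardTransport

theorem theorem2 {d m : ℕ} (S : Matrix (Fin d) (Fin d) ℝ)
    (hS : BackwardTransport.IsSymWithIndex d m S)
    (ν : Measure (EuclideanSpace ℝ (Fin d))) [IsProbabilityMeasure ν]
    (hν : MemLp (fun y => y) 2 ν)
    (γ : Measure (EuclideanSpace ℝ (Fin d) × EuclideanSpace ℝ (Fin d)))
    (hγ : BackwardTransport.IsPlan ν γ)
    (G : Set (EuclideanSpace ℝ (Fin d))) (hG : BackwardTransport.MaximalSMonotone S G) :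
    List.TFAE [
      BackwardTransport.IsOptimalPlan S ν γ ∧ BackwardTransport.IsOptimalSet S ν G,
      ∀ p ∈ γ.support, p.1 ∈ BackwardTransport.sProj S G p.2,
      ∀ᵐ p ∂γ, p.1 ∈ BackwardTransport.sProj S G p.1 ∧
        BackwardTransport.sProj S G p.1 ⊆ BackwardTransport.sProj S G p.2] := by
  have hsupp : (∀ᵐ p ∂γ, p.1 ∈ BackwardTransport.sProj S G p.2) →
      ∀ p ∈ γ.support, p.1 ∈ BackwardTransport.sProj S G p.2 := fun h =>
    Measure.support_subset_of_isClosed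
      (BackwardTransport.isClosed_setOf_mem_sProj (hG.isClosed)) h
  tfae_have 1 → 2 := by
    rintro ⟨hopt, hGopt⟩
    obtain ⟨H, hH, hle⟩ := hopt.exists_maximalSMonotone hS
    exact hsupp (hγ.ae_mem_sProj hS hG ((hGopt.2 H hH).trans hle))
  tfae_have 2 → 3 := by
    intro h
    have hae : ∀ᵐ p ∂γ, p.1 ∈ BackwardTransport.sProj S G p.2 :=
      Filter.Eventually.mono (Measure.support_mem_ae (μ := γ)) h
    filter_upwards [hae, hγ.ae_sProj_subset hS hG hae] with p hp hp'
    exact ⟨BackwardTransport.mem_sProj_self hG.1 hp.1, hp'⟩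
  tfae_have 3 → 1 := by
    intro h
    have heq := hγ.erealIntegral_eq hS (h.mono fun p hp => hp.2 hp.1)
    refine ⟨⟨hγ, fun γ' hγ' => ?_⟩, hG, fun H hH => ?_⟩
    · have h' := hγ'.planValue_le hS hG
      rw [heq] at h'
      exact EReal.coe_le_coe_iff.mp h'
    · rw [heq]
      exact hγ.planValue_le hS hH
  tfae_finish
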